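/- Let $\mathbb F\in\{\mathbb R,\mathbb C\}$. For a matrix $B$, $B^*$ is its conjugate transpose, $\|B\|$ its operator norm with respect to the Euclidean norms, and $\sigma_k(B)=\sqrt{\lambda_k(B^*B)}$ its $k$-th largest singular value. A rank-$r$ truncated SVD of $B$ is a product $USV^*$ in which $U$ and $V$ consist of the first $r$ left and right singular vectors of some singular value decomposition of $B$ with singular values in non-increasing order, and $S=\operatorname{diag}(\sigma_1(B),\dots,\sigma_r(B))$. For matrices $V,W$ with $r$ orthonormal columns, $\sin(V,W)$ is the diagonal matrix of the sines of the principal angles $\theta_k=\arccos\sigma_k(V^*W)$, $1\le k\le r$. A real random variable $\xi$ has $\|\xi\|_{\psi_2}=\inf\{t>0:\mathbb E e^{|\xi|^2/t^2}\le 2\}$. A mean-zero random vector $y$ in $\mathbb R^p$ with finite second moments is $K$-subgaussian if $\|\langle y,x\rangle\|_{\psi_2}\le K(\mathbb E\langle y,x\rangle^2)^{1/2}$ for all $x\in\mathbb R^p$; a random vector in $\mathbb C^p$ is $K$-subgaussian if its real and imaginary parts are. A random vector $y$ in $\mathbb F^p$ is isotropic if $\mathbb E(yy^*)=I_p$. **Theorem.**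 There is an absolute constant $C>0$, and for every $\tau>0$ there are constants $\alpha_\tau\ge 0$ and $c_\tau>0$ depending only on $\tau$, such that the following holds. Let $p_1,p_2,r$ be integers with $1\le r\le\min\{p_1,p_2\}$, let $X\in\mathbb F^{p_1\times p_2}$ have rank $r$, with rank-$r$ truncated SVD $USV^*$, and let $Z\in\mathbb F^{p_1\times p_2}$ be a random matrix whose rows $z_1^*,\dots,z_{p_1}^*$ are such that $z_1,\dots,z_{p_1}$ are independent, isotropic, $\tau$-subgaussian random vectors. Put $Y=X+Z$. Then for every $\alpha\ge\alpha_\tau$, with probability at least $1-e^{-c_\tau\alpha p_2}$, every rank-$r$ truncated SVD $\hat U\hat S\hat V^*$ of $Y$ satisfies $$\|\sin(V,\hat V)\|^2\le\min\left\{1,\ \frac{C\,\alpha\,p_2\,(\sigma_r^2(X)+p_1)}{\sigma_r^4(X)}\right\}.$$ -/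

import Mathlib

open MeasureTheory ProbabilityTheory
open scoped Matrix ENNReal

noncomputable section

namespace SubspaceSVD

section LinearAlgebra

variable {𝕜 : Type*} [RCLike 𝕜] {m n r : ℕ}

/-- The `k`-th largest singular value `σ_k(A) = √(λ_k(Aᴴ A))` of a matrix, counted from `k = 1`
(Mathlib counts singular values from `0`). For `k > n` it is `0`. -/
def sval (A : Matrix (Fin m) (Fin n) 𝕜) (k : ℕ) : ℝ :=
  (Matrix.toEuclideanLin A).singularValues (k - 1)

/-- The operator norm of a matrix with respect to the Euclidean norms. -/
def opNorm (A : Matrix (Fin m) (Fin n) 𝕜) : ℝ :=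
  ‖LinearMap.toContinuousLinearMap (Matrix.toEuclideanLin A)‖

/-- The `m × n` rectangular diagonal matrix with diagonal `σ_1(A), σ_2(A), …`. -/
def svalMatrix (A : Matrix (Fin m) (Fin n) 𝕜) : Matrix (Fin m) (Fin n) 𝕜 :=
  Matrix.of fun i j => if (i : ℕ) = (j : ℕ) then ((sval A (j + 1) : ℝ) : 𝕜) else 0

/-- `A = U Σ Vᴴ` is a (full) singular value decomposition of `A`: `U` and `V` are unitary, and `Σ`
is the rectangular diagonal matrix of the singular values of `A` in non-increasing order. -/
def IsSVD (A : Matrix (Fin m) (Fin n) 𝕜) (U : Matrix (Fin m) (Fin m) 𝕜)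
    (V : Matrix (Fin n) (Fin n) 𝕜) : Prop :=
  U ∈ Matrix.unitaryGroup (Fin m) 𝕜 ∧ V ∈ Matrix.unitaryGroup (Fin n) 𝕜 ∧
    A = U * svalMatrix A * Vᴴ

/-- `U S Vᴴ` is a rank-`r` truncated singular value decomposition of `A`: for some singular value
decomposition of `A`, the columns of `U` and `V` are the first `r` left and right singular vectors,
and `S = diag(σ_1(A), …, σ_r(A))`. -/
def IsTruncatedSVD (hm : r ≤ m) (hn : r ≤ n) (A : Matrix (Fin m) (Fin n) 𝕜)
    (U : Matrix (Fin m) (Fin r) 𝕜) (S : Matrix (Fin r) (Fin r) 𝕜)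
    (V : Matrix (Fin n) (Fin r) 𝕜) : Prop :=
  ∃ (U' : Matrix (Fin m) (Fin m) 𝕜) (V' : Matrix (Fin n) (Fin n) 𝕜), IsSVD A U' V' ∧
    U = U'.submatrix id (Fin.castLE hm) ∧
    S = Matrix.diagonal (fun k : Fin r => ((sval A (k + 1) : ℝ) : 𝕜)) ∧
    V = V'.submatrix id (Fin.castLE hn)

/-- The `k`-th principal angle (`k = 0, …, r - 1`) between the column spaces of two matrices `V`
and `W` with `r` orthonormal columns; its cosine is the singular value `σ_{k+1}(Vᴴ W)`. -/
def principalAngle (V W : Matrix (Fin n) (Fin r) 𝕜) (k : Fin r) : ℝ :=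
  Real.arccos (sval (Vᴴ * W) (k + 1))

/-- The diagonal matrix `sin(V, W)` of the sines of the principal angles. -/
def sinMatrix (V W : Matrix (Fin n) (Fin r) 𝕜) : Matrix (Fin r) (Fin r) ℝ :=
  Matrix.diagonal fun k => Real.sin (principalAngle V W k)

end LinearAlgebra

section Probability

variable {Ω : Type*} [MeasurableSpace Ω]

/-- The `ψ₂`-norm `inf {t > 0 : 𝔼 exp(|X|² / t²) ≤ 2}` of a real random variable
(infinite if there is no such `t`). -/
def psiTwoNorm (X : Ω → ℝ) (μ : Measure Ω) : ℝ≥0∞ :=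
  ⨅ (t : ℝ) (_ : 0 < t ∧ ∫⁻ ω, ENNReal.ofReal (Real.exp (|X ω| ^ 2 / t ^ 2)) ∂μ ≤ 2),
    ENNReal.ofReal t

/-- A square-integrable mean-zero random vector `y` in `ℝ^p` is `K`-subgaussian if
`‖⟨y, x⟩‖_{ψ₂} ≤ K ‖⟨y, x⟩‖_{L₂}` for all `x ∈ ℝ^p`. -/
def IsSubgaussianReal {p : ℕ} (K : ℝ) (y : Ω → Fin p → ℝ) (μ : Measure Ω) : Prop :=
  (∀ i, MemLp (fun ω => y ω i) 2 μ) ∧ (∀ i, ∫ ω, y ω i ∂μ = 0) ∧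
    ∀ x : Fin p → ℝ, psiTwoNorm (fun ω => y ω ⬝ᵥ x) μ ≤
      ENNReal.ofReal K * eLpNorm (fun ω => y ω ⬝ᵥ x) 2 μ

/-- A random vector in `𝔽^p` is `K`-subgaussian if its real and imaginary parts are
(over `ℝ` the imaginary part is zero and its condition is void). -/
def IsSubgaussian {𝕜 : Type*} [RCLike 𝕜] {p : ℕ} (K : ℝ) (y : Ω → Fin p → 𝕜)
    (μ : Measure Ω) : Prop :=
  IsSubgaussianReal K (fun ω i => RCLike.re (y ω i)) μ ∧
    IsSubgaussianReal K (fun ω i => RCLike.im (y ω i)) μ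

/-- A square-integrable random vector `y` in `𝔽^p` is isotropic if `𝔼 (y yᴴ) = I_p`. -/
def IsIsotropic {𝕜 : Type*} [RCLike 𝕜] {p : ℕ} (y : Ω → Fin p → 𝕜) (μ : Measure Ω) : Prop :=
  (∀ i, MemLp (fun ω => y ω i) 2 μ) ∧
    ∀ i j, ∫ ω, y ω i * star (y ω j) ∂μ = (1 : Matrix (Fin p) (Fin p) 𝕜) i j

/-- The random vector `z_k` in `𝔽^{p₂}` for which `z_kᴴ` is the `k`-th row of the random
matrix `Z`. -/
def rowVec {𝕜 : Type*} [RCLike 𝕜] {p₁ p₂ : ℕ} (Z : Ω → Matrix (Fin p₁) (Fin p₂) 𝕜)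
    (k : Fin p₁) : Ω → Fin p₂ → 𝕜 :=
  fun ω j => star (Z ω k j)

end Probability

end SubspaceSVD

end

open SubspaceSVD

/-! Let `V`, `V'` be the leading right singular subspaces of `X` and `Y = X + Z`, and let `v ∈ V` be
a unit principal vector of largest angle to `V'`. Its component `u` orthogonal to `V'` has norm `h`,
the sine of that angle, and `u = h² v + w` with `w ⟂ V`, so that `X w = 0`. Since `Y u` is
orthogonal to `Y (v - u)`, Weyl's inequality `σ_{r+1}(Y) ≤ ‖Z‖` gives
`h² ‖Y v‖² + Re ⟪Y w, Y v⟫ = ‖Y u‖² ≤ ‖Z‖² h²`.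
Suppose that `Zᴴ Z` equals `p₁` up to an operator of norm `ε`, and that `Z` followed by the
projection onto the range of `X` has norm at most `ρ`. The terms `p₁ h²` on the two sides then
cancel, which leaves `h ≲ ρ / σ_r + ε / σ_r²`.

Sub-Gaussian and Bernstein tail bounds for fixed vectors, combined with union bounds over nets of
the unit balls, allow `ρ = √q` and `ε = √(q p₁) + q` for `q = α p₂`, outside an event of probability
`exp (-c q)`. If `1000 q (σ_r² + p₁) > σ_r⁴`, the claimed bound is the trivial one. -/

namespace SubspaceSVD

open Module
open scoped InnerProductSpace NNReal
open Matrix (toEuclideanLin)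

section SingularBasis

variable {𝕜 E F : Type*} [RCLike 𝕜] [NormedAddCommGroup E] [InnerProductSpace 𝕜 E]

lemma inner_eq_zero_of_mem_span {ι : Type*} [Fintype ι] {b : OrthonormalBasis ι 𝕜 E} {s : Set ι}
    {x : E} (hx : x ∈ Submodule.span 𝕜 (b '' s)) {i : ι} (hi : i ∉ s) : ⟪b i, x⟫_𝕜 = 0 := by
  suffices Submodule.span 𝕜 (b '' s) ≤ (𝕜 ∙ b i)ᗮ from
    (Submodule.mem_orthogonal_singleton_iff_inner_right).1 (this hx)
  rw [Submodule.span_le]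
  rintro _ ⟨j, hj, rfl⟩
  exact Submodule.mem_orthogonal_singleton_iff_inner_right.2
    (b.inner_eq_zero (ne_of_mem_of_not_mem hj hi).symm)

lemma inner_eq_zero_of_mem_span_orthogonal {ι : Type*} [Fintype ι] {b : OrthonormalBasis ι 𝕜 E}
    {s : Set ι} {x : E} (hx : x ∈ (Submodule.span 𝕜 (b '' s))ᗮ) {i : ι} (hi : i ∈ s) :
    ⟪b i, x⟫_𝕜 = 0 :=
  (Submodule.mem_orthogonal _ _).1 hx _ (Submodule.subset_span (Set.mem_image_of_mem b hi))

variable [FiniteDimensional 𝕜 E] [NormedAddCommGroup F] [InnerProductSpace 𝕜 F]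
  [FiniteDimensional 𝕜 F] {n : ℕ}

/-- The orthonormal basis `b` consists of right singular vectors of `T`, listed in non-increasing
order of the singular values (counted from `0`, as in Mathlib). -/
def IsRightSingularBasis (T : E →ₗ[𝕜] F) (b : OrthonormalBasis (Fin n) 𝕜 E) : Prop :=
  ∀ i j, ⟪T (b i), T (b j)⟫_𝕜 = if i = j then ((T.singularValues i ^ 2 : ℝ) : 𝕜) else 0

lemma exists_isRightSingularBasis (T : E →ₗ[𝕜] F) :
    ∃ b : OrthonormalBasis (Fin (finrank 𝕜 E)) 𝕜 E, IsRightSingularBasis T b := by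
  have hT := T.isSymmetric_adjoint_comp_self
  refine ⟨hT.eigenvectorBasis rfl, fun i j => ?_⟩
  rw [← LinearMap.adjoint_inner_right, ← LinearMap.comp_apply, hT.apply_eigenvectorBasis,
    inner_smul_right, OrthonormalBasis.inner_eq_ite, T.sq_singularValues_fin rfl]
  split_ifs with h
  · rw [h, mul_one]
  · rw [mul_zero]

namespace IsRightSingularBasis

variable {T : E →ₗ[𝕜] F} {b : OrthonormalBasis (Fin n) 𝕜 E} (hb : IsRightSingularBasis T b)
include hb

lemma inner_map_map (x y : E) :
    ⟪T x, T y⟫_𝕜 = ∑ i : Fin n, ((T.singularValues i ^ 2 : ℝ) : 𝕜) * (⟪x, b i⟫_𝕜 * ⟪b i, y⟫_𝕜) := by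
  conv_lhs => rw [← b.sum_repr' x, ← b.sum_repr' y]
  simp only [map_sum, map_smul, sum_inner, inner_sum, inner_smul_left, inner_smul_right, hb _ _,
    mul_ite, mul_zero, Finset.sum_ite_eq', Finset.mem_univ, if_true, inner_conj_symm]
  exact Finset.sum_congr rfl fun i _ => by ring

lemma norm_sq_map (x : E) :
    ‖T x‖ ^ 2 = ∑ i : Fin n, T.singularValues i ^ 2 * ‖⟪b i, x⟫_𝕜‖ ^ 2 := by
  have h := hb.inner_map_map x x
  simp only [inner_self_eq_norm_sq_to_K, ← inner_conj_symm x, RCLike.conj_mul] at h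
  exact_mod_cast h

lemma singularValues_mul_norm_le {k : ℕ} {x : E} (hx : ∀ i : Fin n, k < i → ⟪b i, x⟫_𝕜 = 0) :
    T.singularValues k * ‖x‖ ≤ ‖T x‖ := by
  refine le_of_sq_le_sq ?_ (norm_nonneg _)
  rw [mul_pow, hb.norm_sq_map, ← b.sum_sq_norm_inner_right, Finset.mul_sum]
  refine Finset.sum_le_sum fun i _ => ?_
  rcases lt_or_ge k i with hi | hi
  · simp [hx i hi]
  · have := T.singularValues_antitone hi
    have := T.singularValues_nonneg k
    gcongr

lemma norm_map_le {k : ℕ} {x : E} (hx : ∀ i : Fin n, i < k → ⟪b i, x⟫_𝕜 = 0) :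
    ‖T x‖ ≤ T.singularValues k * ‖x‖ := by
  refine le_of_sq_le_sq ?_ (mul_nonneg (T.singularValues_nonneg k) (norm_nonneg _))
  rw [mul_pow, hb.norm_sq_map, ← b.sum_sq_norm_inner_right, Finset.mul_sum]
  refine Finset.sum_le_sum fun i _ => ?_
  rcases lt_or_ge (i : ℕ) k with hi | hi
  · simp [hx i hi]
  · have := T.singularValues_antitone hi
    have := T.singularValues_nonneg i
    gcongr

lemma inner_map_map_eq_zero {k : ℕ} {x y : E} (hx : ∀ i : Fin n, i < k → ⟪b i, x⟫_𝕜 = 0)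
    (hy : ∀ i : Fin n, k ≤ i → ⟪b i, y⟫_𝕜 = 0) : ⟪T x, T y⟫_𝕜 = 0 := by
  rw [hb.inner_map_map]
  refine Finset.sum_eq_zero fun i _ => ?_
  rcases lt_or_ge (i : ℕ) k with hi | hi
  · simp [inner_eq_zero_symm.1 (hx i hi)]
  · simp [hy i hi]

end IsRightSingularBasis

/-- `K` is spanned by the first `r` vectors of an orthonormal basis of right singular vectors of
`T` in non-increasing order. -/
def IsLeadingRightSingularSubspace (T : E →ₗ[𝕜] F) (r : ℕ) (K : Submodule 𝕜 E) : Prop :=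
  ∃ (n : ℕ) (b : OrthonormalBasis (Fin n) 𝕜 E), IsRightSingularBasis T b ∧
    K = Submodule.span 𝕜 (b '' {i | i < r})

namespace IsLeadingRightSingularSubspace

variable {T : E →ₗ[𝕜] F} {r : ℕ} {K : Submodule 𝕜 E}

lemma singularValues_mul_norm_le (hK : IsLeadingRightSingularSubspace T (r + 1) K) {x : E}
    (hx : x ∈ K) : T.singularValues r * ‖x‖ ≤ ‖T x‖ := by
  obtain ⟨n, b, hb, rfl⟩ := hK
  exact hb.singularValues_mul_norm_le fun i hi =>
    inner_eq_zero_of_mem_span hx (Nat.not_lt.2 hi)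

lemma norm_map_le (hK : IsLeadingRightSingularSubspace T r K) {x : E} (hx : x ∈ Kᗮ) :
    ‖T x‖ ≤ T.singularValues r * ‖x‖ := by
  obtain ⟨n, b, hb, rfl⟩ := hK
  exact hb.norm_map_le fun i hi => inner_eq_zero_of_mem_span_orthogonal hx hi

lemma inner_map_map_eq_zero (hK : IsLeadingRightSingularSubspace T r K) {x y : E} (hx : x ∈ Kᗮ)
    (hy : y ∈ K) : ⟪T x, T y⟫_𝕜 = 0 := by
  obtain ⟨n, b, hb, rfl⟩ := hK
  exact hb.inner_map_map_eq_zero (fun i hi => inner_eq_zero_of_mem_span_orthogonal hx hi)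
    fun i hi => inner_eq_zero_of_mem_span hy (Nat.not_lt.2 hi)

lemma finrank_eq (hK : IsLeadingRightSingularSubspace T r K) (hr : r ≤ finrank 𝕜 E) :
    finrank 𝕜 K = r := by
  obtain ⟨n, b, -, rfl⟩ := hK
  have hn : finrank 𝕜 E = n := by simpa using finrank_eq_card_basis b.toBasis
  have hr' : Fintype.card {i : Fin n | i < r} = r := by
    simp only [Set.coe_ofPred, Fintype.card_subtype, Fin.card_filter_val_lt]
    omega
  rw [Set.image_eq_range]
  exact (finrank_span_eq_card (b.orthonormal.linearIndependent.comp _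
    Subtype.val_injective)).trans hr'

end IsLeadingRightSingularSubspace

lemma exists_isLeadingRightSingularSubspace (T : E →ₗ[𝕜] F) (r : ℕ) :
    ∃ K, IsLeadingRightSingularSubspace T r K :=
  let ⟨b, hb⟩ := exists_isRightSingularBasis T
  ⟨_, _, b, hb, rfl⟩

lemma exists_mem_inf_ne_zero {K L : Submodule 𝕜 E} (h : finrank 𝕜 E < finrank 𝕜 K + finrank 𝕜 L) :
    ∃ x ∈ K ⊓ L, x ≠ 0 := by
  refine Submodule.exists_mem_ne_zero_of_ne_bot fun hKL => ?_
  have := Submodule.finrank_sup_add_finrank_inf_eq K L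
  have := (K ⊔ L).finrank_le
  rw [hKL, finrank_bot] at *
  omega

lemma singularValues_add_le_of_finrank_range_le {X Z : E →ₗ[𝕜] F} {k : ℕ} {c : ℝ}
    (hX : finrank 𝕜 (LinearMap.range X) ≤ k) (hc : 0 ≤ c) (hZ : ∀ x, ‖Z x‖ ≤ c * ‖x‖) :
    (X + Z).singularValues k ≤ c := by
  rcases le_or_gt (finrank 𝕜 E) k with hk | hk
  · rwa [LinearMap.singularValues_of_finrank_le _ hk]
  obtain ⟨K, hK⟩ := exists_isLeadingRightSingularSubspace (X + Z) (k + 1)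
  obtain ⟨x, ⟨hxK, hxX⟩, hx0⟩ : ∃ x ∈ K ⊓ LinearMap.ker X, x ≠ 0 := by
    refine exists_mem_inf_ne_zero ?_
    rw [hK.finrank_eq hk]
    have := X.finrank_range_add_finrank_ker
    omega
  refine le_of_mul_le_mul_right ?_ (norm_pos_iff.2 hx0)
  calc (X + Z).singularValues k * ‖x‖ ≤ ‖(X + Z) x‖ := hK.singularValues_mul_norm_le hxK
    _ = ‖Z x‖ := by rw [LinearMap.add_apply, LinearMap.mem_ker.1 hxX, zero_add]
    _ ≤ c * ‖x‖ := hZ x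

end SingularBasis

section SingularValueDecomposition

variable {𝕜 ι κ : Type*} [RCLike 𝕜] [Fintype ι] [Fintype κ] [DecidableEq κ]

lemma inner_toEuclideanLin_single (A B : Matrix ι κ 𝕜) (i j : κ) :
    ⟪toEuclideanLin A (EuclideanSpace.single i 1), toEuclideanLin B (EuclideanSpace.single j 1)⟫_𝕜 =
      (Aᴴ * B) i j := by
  simp [PiLp.inner_apply, Matrix.toLpLin_apply, Matrix.mul_apply, mul_comm]

lemma exists_orthonormalBasis_of_conjTranspose_mul_self {V : Matrix κ κ 𝕜}
    (hV : Vᴴ * V = 1) :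
    ∃ b : OrthonormalBasis κ 𝕜 (EuclideanSpace 𝕜 κ),
      ∀ j, b j = toEuclideanLin V (EuclideanSpace.single j 1) := by
  have hon : Orthonormal 𝕜 fun j => toEuclideanLin V (EuclideanSpace.single j 1) :=
    orthonormal_iff_ite.2 fun i j => by
      rw [inner_toEuclideanLin_single, hV, Matrix.one_apply]
  exact ⟨.mk hon (hon.linearIndependent.span_eq_top_of_card_eq_finrank' (by simp)).ge,
    fun j => by rw [OrthonormalBasis.coe_mk]⟩

omit [Fintype ι] in
lemma range_toEuclideanLin (V : Matrix ι κ 𝕜) :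
    LinearMap.range (toEuclideanLin V) =
      Submodule.span 𝕜 (Set.range fun j => toEuclideanLin V (EuclideanSpace.single j 1)) := by
  rw [LinearMap.range_eq_map, ← (EuclideanSpace.basisFun κ 𝕜).toBasis.span_eq, Submodule.map_span,
    ← Set.range_comp]
  simp only [OrthonormalBasis.coe_toBasis, Function.comp_def, EuclideanSpace.basisFun_apply]

omit [Fintype ι] in
lemma finrank_range_toEuclideanLin [Finite ι] (A : Matrix ι κ 𝕜) :
    finrank 𝕜 (LinearMap.range (toEuclideanLin A)) = A.rank := by
  classical
  have := Fintype.ofFinite ι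
  rw [Matrix.rank_eq_finrank_range_toLin A (EuclideanSpace.basisFun ι 𝕜).toBasis
    (EuclideanSpace.basisFun κ 𝕜).toBasis, Matrix.toEuclideanLin_eq_toLin_orthonormal]

variable {m n r : ℕ} {A : Matrix (Fin m) (Fin n) 𝕜}

lemma svalMatrix_conjTranspose_mul_self (A : Matrix (Fin m) (Fin n) 𝕜) :
    (svalMatrix A)ᴴ * svalMatrix A =
      Matrix.diagonal fun j : Fin n => ((sval A (j + 1) ^ 2 : ℝ) : 𝕜) := by
  ext i j
  simp only [Matrix.mul_apply, Matrix.diagonal_apply, svalMatrix, Matrix.conjTranspose_apply,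
    Matrix.of_apply]
  rcases lt_or_ge (i : ℕ) m with hi | hi
  · rw [Finset.sum_eq_single_of_mem ⟨i, hi⟩ (Finset.mem_univ _)
      fun k _ hk => by simp [Fin.val_ne_of_ne hk]]
    rcases eq_or_ne i j with rfl | hij
    · simp [pow_two]
    · simp [Fin.val_ne_of_ne hij, hij]
  · have h0 : sval A (i + 1) = 0 := by
      rw [sval, Nat.add_sub_cancel, LinearMap.singularValues_eq_zero_iff_le_finrank_range,
        finrank_range_toEuclideanLin]
      exact A.rank_le_height.trans hi
    have hk (k : Fin m) : (k : ℕ) ≠ i := (k.2.trans_le hi).ne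
    simp [h0, hk]

lemma IsSVD.isRightSingularBasis {U : Matrix (Fin m) (Fin m) 𝕜} {V : Matrix (Fin n) (Fin n) 𝕜}
    (h : IsSVD A U V) {b : OrthonormalBasis (Fin n) 𝕜 (EuclideanSpace 𝕜 (Fin n))}
    (hb : ∀ j, b j = toEuclideanLin V (EuclideanSpace.single j 1)) :
    IsRightSingularBasis (toEuclideanLin A) b := by
  obtain ⟨hU, hV, hA⟩ := h
  have hUU : Uᴴ * U = 1 := Matrix.mem_unitaryGroup_iff'.1 hU
  have hVV : Vᴴ * V = 1 := Matrix.mem_unitaryGroup_iff'.1 hV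
  have hAV : A * V = U * svalMatrix A := by
    conv_lhs => rw [hA, Matrix.mul_assoc, hVV, Matrix.mul_one]
  have hgram : (A * V)ᴴ * (A * V) = (svalMatrix A)ᴴ * svalMatrix A := by
    rw [hAV, Matrix.conjTranspose_mul, Matrix.mul_assoc, ← Matrix.mul_assoc Uᴴ,
      hUU, Matrix.one_mul]
  intro i j
  rw [hb, hb, ← LinearMap.comp_apply, ← LinearMap.comp_apply, ← Matrix.toLpLin_mul,
    inner_toEuclideanLin_single, hgram, svalMatrix_conjTranspose_mul_self, Matrix.diagonal_apply]
  rfl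

variable {hm : r ≤ m} {hn : r ≤ n} {U : Matrix (Fin m) (Fin r) 𝕜} {S : Matrix (Fin r) (Fin r) 𝕜}
  {V : Matrix (Fin n) (Fin r) 𝕜}

lemma IsTruncatedSVD.conjTranspose_mul_self (h : IsTruncatedSVD hm hn A U S V) : Vᴴ * V = 1 := by
  obtain ⟨_, V', ⟨-, hV', -⟩, -, -, rfl⟩ := h
  have hVV : V'ᴴ * V' = 1 := Matrix.mem_unitaryGroup_iff'.1 hV'
  rw [Matrix.conjTranspose_submatrix, ← Matrix.submatrix_mul _ _ _ _ _ Function.bijective_id, hVV,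
    Matrix.submatrix_one _ (Fin.castLE_injective hn)]

lemma IsTruncatedSVD.isLeadingRightSingularSubspace (h : IsTruncatedSVD hm hn A U S V) :
    IsLeadingRightSingularSubspace (toEuclideanLin A) r (LinearMap.range (toEuclideanLin V)) := by
  obtain ⟨_, V', hSVD, -, -, rfl⟩ := h
  obtain ⟨b, hb⟩ := exists_orthonormalBasis_of_conjTranspose_mul_self
    (Matrix.mem_unitaryGroup_iff'.1 hSVD.2.1)
  refine ⟨n, b, hSVD.isRightSingularBasis hb, ?_⟩
  rw [range_toEuclideanLin]
  have hcol (j : Fin r) : toEuclideanLin (V'.submatrix id (Fin.castLE hn))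
      (EuclideanSpace.single j 1) = b (Fin.castLE hn j) := by
    rw [hb]
    ext i
    simp [Matrix.toLpLin_apply]
  have hset : {i : Fin n | (i : ℕ) < r} = Set.range (Fin.castLE hn) := (Fin.range_castLE hn).symm
  simp only [hcol, hset, ← Set.range_comp, Function.comp_def]

end SingularValueDecomposition

section PrincipalVectors

variable {𝕜 E G : Type*} [RCLike 𝕜] [NormedAddCommGroup E] [InnerProductSpace 𝕜 E]
  [FiniteDimensional 𝕜 E] [NormedAddCommGroup G] [InnerProductSpace 𝕜 G] [FiniteDimensional 𝕜 G]

lemma hasEigenvalue_mul_comm {M : Type*} [AddCommGroup M] [Module 𝕜 M] [FiniteDimensional 𝕜 M]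
    (f g : Module.End 𝕜 M) (c : 𝕜) : (f * g).HasEigenvalue c ↔ (g * f).HasEigenvalue c := by
  have hchar : (f * g).charpoly = (g * f).charpoly := by
    let b := Module.finBasis 𝕜 M
    rw [← LinearMap.charpoly_toMatrix _ b, ← LinearMap.charpoly_toMatrix _ b,
      LinearMap.toMatrix_mul, LinearMap.toMatrix_mul, Matrix.charpoly_mul_comm]
  rw [Module.End.hasEigenvalue_iff_isRoot_charpoly, hchar,
    ← Module.End.hasEigenvalue_iff_isRoot_charpoly]

lemma exists_norm_eq_one_comp_adjoint_apply_eq (T : Module.End 𝕜 E) {k : ℕ}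
    (hk : k < finrank 𝕜 E) :
    ∃ y : E, ‖y‖ = 1 ∧ T (LinearMap.adjoint T y) = ((T.singularValues k ^ 2 : ℝ) : 𝕜) • y := by
  have hev := (hasEigenvalue_mul_comm (LinearMap.adjoint T) T _).1
    (T.hasEigenvalue_adjoint_comp_self_sq_singularValues hk)
  obtain ⟨y, hy⟩ := hev.exists_hasEigenvector
  have hTy : T (LinearMap.adjoint T y) = ((T.singularValues k : 𝕜) ^ 2) • y := hy.apply_eq_smul
  refine ⟨((‖y‖⁻¹ : ℝ) : 𝕜) • y, ?_, ?_⟩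
  · rw [norm_smul, RCLike.norm_ofReal, abs_inv, abs_norm, inv_mul_cancel₀ (norm_ne_zero_iff.2 hy.2)]
  · rw [map_smul, map_smul, hTy, smul_comm, RCLike.ofReal_pow]

lemma exists_principal_vector {V W : G →ₗ[𝕜] E} (hV : LinearMap.adjoint V ∘ₗ V = .id)
    (hW : LinearMap.adjoint W ∘ₗ W = .id) {k : ℕ} (hk : k < finrank 𝕜 G) :
    ∃ v ∈ LinearMap.range V, ∃ u ∈ (LinearMap.range W)ᗮ, ‖v‖ = 1 ∧ v - u ∈ LinearMap.range W ∧
      ‖u‖ ^ 2 = 1 - (LinearMap.adjoint V ∘ₗ W).singularValues k ^ 2 ∧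
      u - ((‖u‖ ^ 2 : ℝ) : 𝕜) • v ∈ (LinearMap.range V)ᗮ := by
  obtain ⟨y, hy1, hy⟩ := exists_norm_eq_one_comp_adjoint_apply_eq (LinearMap.adjoint V ∘ₗ W) hk
  set σ := (LinearMap.adjoint V ∘ₗ W).singularValues k
  set v := V y with hv
  set w := W (LinearMap.adjoint W v) with hw
  rw [LinearMap.adjoint_comp, LinearMap.adjoint_adjoint] at hy
  have hVv : LinearMap.adjoint V v = y := LinearMap.congr_fun hV y
  have hVw : LinearMap.adjoint V w = ((σ ^ 2 : ℝ) : 𝕜) • y := hy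
  have hWu : LinearMap.adjoint W (v - w) = 0 := by
    rw [map_sub, sub_eq_zero]
    exact (LinearMap.congr_fun hW (LinearMap.adjoint W v)).symm
  have hv1 : ‖v‖ = 1 := by
    rw [← hy1, ← sq_eq_sq₀ (norm_nonneg _) (norm_nonneg _), ← inner_self_eq_norm_sq (𝕜 := 𝕜),
      ← LinearMap.adjoint_inner_right, hVv, inner_self_eq_norm_sq]
  have huw : ⟪v - w, w⟫_𝕜 = 0 := by rw [hw, ← LinearMap.adjoint_inner_left, hWu, inner_zero_left]
  have hvw : ⟪v, w⟫_𝕜 = ((σ ^ 2 : ℝ) : 𝕜) := by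
    rw [hv, ← LinearMap.adjoint_inner_right, hVw, inner_smul_right, inner_self_eq_norm_sq_to_K, hy1]
    simp
  have hu : ‖v - w‖ ^ 2 = 1 - σ ^ 2 := by
    have : RCLike.re ⟪v - w, v - w⟫_𝕜 = 1 - σ ^ 2 := by
      rw [inner_sub_right, huw, sub_zero, inner_sub_left, ← inner_conj_symm w, hvw, map_sub,
        inner_self_eq_norm_sq, hv1, RCLike.conj_ofReal, RCLike.ofReal_re, one_pow]
    rwa [inner_self_eq_norm_sq] at this
  refine ⟨v, ⟨y, rfl⟩, v - w, ?_, hv1, ⟨_, (sub_sub_cancel v w).symm⟩, hu, ?_⟩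
  · rwa [LinearMap.orthogonal_range, LinearMap.mem_ker]
  · rw [LinearMap.orthogonal_range, LinearMap.mem_ker, hu, map_sub, map_sub, map_smul, hVv, hVw]
    push_cast
    module

open scoped Matrix.Norms.L2Operator in
lemma opNorm_sinMatrix_le {n r : ℕ} {V W : Matrix (Fin n) (Fin r) 𝕜} {B : ℝ} (hB : 0 ≤ B)
    (h : ∀ k, Real.sin (principalAngle V W k) ≤ B) : opNorm (sinMatrix V W) ≤ B := by
  have : opNorm (sinMatrix V W) = ‖sinMatrix V W‖ := rfl
  rw [this, sinMatrix, Matrix.l2_opNorm_diagonal, pi_norm_le_iff_of_nonneg hB]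
  intro k
  rw [principalAngle, Real.sin_arccos, Real.norm_of_nonneg (Real.sqrt_nonneg _),
    ← Real.sin_arccos]
  exact h k

end PrincipalVectors

section Perturbation

lemma le_of_sq_mul_le {s t h ρ ε : ℝ} (hs : 0 < s) (hst : s ≤ t) (hh : 0 ≤ h) (hρ : 0 ≤ ρ)
    (hρs : 16 * ρ ≤ s) (hε : 0 ≤ ε) (hεs : 16 * ε ≤ s ^ 2)
    (H : h ^ 2 * (t ^ 2 - 2 * (ρ * t) - 2 * ε) ≤ h * (ρ * t + ε)) :
    h ≤ 4 / 3 * (ρ / s + ε / s ^ 2) := by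
  rcases hh.eq_or_lt with rfl | hpos
  · positivity
  have ht : 0 < t := hs.trans_le hst
  have hρt : ρ * t ≤ t ^ 2 / 16 := by nlinarith
  have hεt : ε ≤ t ^ 2 / 16 := by nlinarith
  have hmain : h * (3 / 4 * t ^ 2) ≤ ρ * t + ε := by
    refine le_of_mul_le_mul_left ?_ hpos
    calc h * (h * (3 / 4 * t ^ 2)) = h ^ 2 * (3 / 4 * t ^ 2) := by ring
      _ ≤ h ^ 2 * (t ^ 2 - 2 * (ρ * t) - 2 * ε) := by gcongr; linarith
      _ ≤ h * (ρ * t + ε) := H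
  calc h ≤ 4 / 3 * (ρ * t + ε) / t ^ 2 := by
        rw [le_div_iff₀ (by positivity)]
        linarith
    _ = 4 / 3 * (ρ / t + ε / t ^ 2) := by field_simp
    _ ≤ 4 / 3 * (ρ / s + ε / s ^ 2) := by gcongr

variable {𝕜 E F : Type*} [RCLike 𝕜] [NormedAddCommGroup E] [InnerProductSpace 𝕜 E]
  [NormedAddCommGroup F] [InnerProductSpace 𝕜 F] {X Z : E →ₗ[𝕜] F} {p ρ ε : ℝ}

lemma norm_map_le_of_norm_inner_sub_le
    (hZ : ∀ x y, ‖⟪Z x, Z y⟫_𝕜 - p * ⟪x, y⟫_𝕜‖ ≤ ε * ‖x‖ * ‖y‖) (x : E) :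
    ‖Z x‖ ≤ √(p + ε) * ‖x‖ := by
  have h := (RCLike.re_le_norm _).trans (hZ x x)
  rw [map_sub, RCLike.re_ofReal_mul, inner_self_eq_norm_sq, inner_self_eq_norm_sq] at h
  rw [← Real.sqrt_sq (norm_nonneg x), ← Real.sqrt_mul' _ (sq_nonneg _)]
  exact Real.le_sqrt_of_sq_le (by linarith)

lemma le_norm_sq_add_map (hX : ∀ x y, ‖⟪X x, Z y⟫_𝕜‖ ≤ ρ * ‖X x‖ * ‖y‖)
    (hZ : ∀ x y, ‖⟪Z x, Z y⟫_𝕜 - p * ⟪x, y⟫_𝕜‖ ≤ ε * ‖x‖ * ‖y‖) {v : E} (hv : ‖v‖ = 1) :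
    ‖X v‖ ^ 2 - 2 * (ρ * ‖X v‖) + p - ε ≤ ‖(X + Z) v‖ ^ 2 := by
  have hcross := (abs_le.1 ((RCLike.abs_re_le_norm _).trans (hX v v))).1
  have hquad := (abs_le.1 ((RCLike.abs_re_le_norm _).trans (hZ v v))).1
  rw [map_sub, RCLike.re_ofReal_mul, inner_self_eq_norm_sq, inner_self_eq_norm_sq, hv] at hquad
  rw [hv] at hcross
  rw [LinearMap.add_apply, norm_add_sq (𝕜 := 𝕜)]
  linarith

lemma neg_le_re_inner_add_map (hX : ∀ x y, ‖⟪X x, Z y⟫_𝕜‖ ≤ ρ * ‖X x‖ * ‖y‖)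
    (hZ : ∀ x y, ‖⟪Z x, Z y⟫_𝕜 - p * ⟪x, y⟫_𝕜‖ ≤ ε * ‖x‖ * ‖y‖) {v w : E} (hv : ‖v‖ = 1)
    (hXw : X w = 0) (hwv : ⟪w, v⟫_𝕜 = 0) :
    -((ρ * ‖X v‖ + ε) * ‖w‖) ≤ RCLike.re ⟪(X + Z) w, (X + Z) v⟫_𝕜 := by
  have hcross := (abs_le.1 ((RCLike.abs_re_le_norm _).trans (hX v w))).1
  have hquad := (abs_le.1 ((RCLike.abs_re_le_norm _).trans (hZ w v))).1
  rw [hwv, mul_zero, sub_zero, hv] at hquad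
  rw [LinearMap.add_apply, LinearMap.add_apply, hXw, zero_add, inner_add_right, map_add,
    inner_re_symm]
  linarith

lemma norm_le_of_re_inner_add_map_le (hX : ∀ x y, ‖⟪X x, Z y⟫_𝕜‖ ≤ ρ * ‖X x‖ * ‖y‖)
    (hZ : ∀ x y, ‖⟪Z x, Z y⟫_𝕜 - p * ⟪x, y⟫_𝕜‖ ≤ ε * ‖x‖ * ‖y‖) {s : ℝ} (hs : 0 < s) (hρ : 0 ≤ ρ)
    (hρs : 16 * ρ ≤ s) (hε : 0 ≤ ε) (hεs : 16 * ε ≤ s ^ 2) {u v w : E} (hv : ‖v‖ = 1)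
    (hXv : s ≤ ‖X v‖) (hu : u = ((‖u‖ ^ 2 : ℝ) : 𝕜) • v + w) (hXw : X w = 0) (hwv : ⟪w, v⟫_𝕜 = 0)
    (hY : RCLike.re ⟪(X + Z) u, (X + Z) v⟫_𝕜 ≤ (p + ε) * ‖u‖ ^ 2) :
    ‖u‖ ≤ 4 / 3 * (ρ / s + ε / s ^ 2) := by
  have hwu : ‖w‖ ≤ ‖u‖ := by
    refine le_of_sq_le_sq ?_ (norm_nonneg _)
    conv_rhs => rw [hu, norm_add_sq (𝕜 := 𝕜), inner_smul_left, inner_eq_zero_symm.1 hwv, mul_zero,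
      map_zero, mul_zero, add_zero]
    exact le_add_of_nonneg_left (sq_nonneg _)
  have hsplit : RCLike.re ⟪(X + Z) u, (X + Z) v⟫_𝕜 =
      ‖u‖ ^ 2 * ‖(X + Z) v‖ ^ 2 + RCLike.re ⟪(X + Z) w, (X + Z) v⟫_𝕜 := by
    conv_lhs => rw [hu, map_add, map_smul, inner_add_left, map_add, inner_smul_left,
      RCLike.conj_ofReal, RCLike.re_ofReal_mul, inner_self_eq_norm_sq]
  have hYv := le_norm_sq_add_map hX hZ hv
  have hYw := neg_le_re_inner_add_map hX hZ hv hXw hwv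
  refine le_of_sq_mul_le hs hXv (norm_nonneg u) hρ hρs hε hεs ?_
  calc ‖u‖ ^ 2 * (‖X v‖ ^ 2 - 2 * (ρ * ‖X v‖) - 2 * ε)
      = ‖u‖ ^ 2 * (‖X v‖ ^ 2 - 2 * (ρ * ‖X v‖) + p - ε) - (p + ε) * ‖u‖ ^ 2 := by ring
    _ ≤ ‖u‖ ^ 2 * ‖(X + Z) v‖ ^ 2 - RCLike.re ⟪(X + Z) u, (X + Z) v⟫_𝕜 := by gcongr
    _ ≤ (ρ * ‖X v‖ + ε) * ‖w‖ := by linarith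
    _ ≤ (ρ * ‖X v‖ + ε) * ‖u‖ := by gcongr
    _ = ‖u‖ * (ρ * ‖X v‖ + ε) := mul_comm _ _

variable [FiniteDimensional 𝕜 E] [FiniteDimensional 𝕜 F]

lemma norm_le_of_isLeadingRightSingularSubspace {r : ℕ} {K L : Submodule 𝕜 E}
    (hrank : finrank 𝕜 (LinearMap.range X) = r + 1)
    (hK : IsLeadingRightSingularSubspace X (r + 1) K)
    (hL : IsLeadingRightSingularSubspace (X + Z) (r + 1) L)
    (hX : ∀ x y, ‖⟪X x, Z y⟫_𝕜‖ ≤ ρ * ‖X x‖ * ‖y‖)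
    (hZ : ∀ x y, ‖⟪Z x, Z y⟫_𝕜 - p * ⟪x, y⟫_𝕜‖ ≤ ε * ‖x‖ * ‖y‖) (hp : 0 ≤ p) (hρ : 0 ≤ ρ)
    (hρs : 16 * ρ ≤ X.singularValues r) (hε : 0 ≤ ε) (hεs : 16 * ε ≤ X.singularValues r ^ 2)
    {u v : E} (hvK : v ∈ K) (hv : ‖v‖ = 1) (huL : u ∈ Lᗮ) (hvuL : v - u ∈ L)
    (hw : u - ((‖u‖ ^ 2 : ℝ) : 𝕜) • v ∈ Kᗮ) :
    ‖u‖ ≤ 4 / 3 * (ρ / X.singularValues r + ε / X.singularValues r ^ 2) := by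
  have hs : 0 < X.singularValues r := by
    rw [LinearMap.singularValues_pos_iff_lt_finrank_range, hrank]
    exact r.lt_succ_self
  have hXv : X.singularValues r ≤ ‖X v‖ := by
    simpa only [hv, mul_one] using hK.singularValues_mul_norm_le hvK
  have hXw : X (u - ((‖u‖ ^ 2 : ℝ) : 𝕜) • v) = 0 := by
    have h0 : X.singularValues (r + 1) = 0 :=
      X.singularValues_eq_zero_iff_le_finrank_range.2 hrank.le
    simpa only [h0, zero_mul, norm_le_zero_iff] using hK.norm_map_le hw
  refine norm_le_of_re_inner_add_map_le hX hZ hs hρ hρs hε hεs hv hXv (add_sub_cancel _ _).symm hXw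
    ((Submodule.mem_orthogonal' _ _).1 hw v hvK) ?_
  have hYuv : ⟪(X + Z) u, (X + Z) v⟫_𝕜 = ⟪(X + Z) u, (X + Z) u⟫_𝕜 := by
    rw [← sub_eq_zero, ← inner_sub_right, ← map_sub]
    exact hL.inner_map_map_eq_zero huL hvuL
  have hσ : (X + Z).singularValues (r + 1) ≤ √(p + ε) :=
    singularValues_add_le_of_finrank_range_le hrank.le (Real.sqrt_nonneg _)
      (norm_map_le_of_norm_inner_sub_le hZ)
  calc RCLike.re ⟪(X + Z) u, (X + Z) v⟫_𝕜 = ‖(X + Z) u‖ ^ 2 := by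
        rw [hYuv, inner_self_eq_norm_sq]
    _ ≤ (√(p + ε) * ‖u‖) ^ 2 := by
        gcongr
        exact (hL.norm_map_le huL).trans (by gcongr)
    _ = (p + ε) * ‖u‖ ^ 2 := by rw [mul_pow, Real.sq_sqrt (by positivity)]

variable {m n r : ℕ} {hm : r ≤ m} {hn : r ≤ n} {A B : Matrix (Fin m) (Fin n) 𝕜}
  {U U' : Matrix (Fin m) (Fin r) 𝕜} {S S' : Matrix (Fin r) (Fin r) 𝕜}
  {V V' : Matrix (Fin n) (Fin r) 𝕜}

lemma opNorm_sinMatrix_le_of_isTruncatedSVD (hr : 1 ≤ r) (hrank : A.rank = r)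
    (hSVD : IsTruncatedSVD hm hn A U S V) (hSVD' : IsTruncatedSVD hm hn (A + B) U' S' V')
    (hA : ∀ x y, ‖⟪toEuclideanLin A x, toEuclideanLin B y⟫_𝕜‖ ≤ ρ * ‖toEuclideanLin A x‖ * ‖y‖)
    (hB : ∀ x y, ‖⟪toEuclideanLin B x, toEuclideanLin B y⟫_𝕜 - p * ⟪x, y⟫_𝕜‖ ≤ ε * ‖x‖ * ‖y‖)
    (hp : 0 ≤ p) (hρ : 0 ≤ ρ) (hρs : 16 * ρ ≤ sval A r) (hε : 0 ≤ ε)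
    (hεs : 16 * ε ≤ sval A r ^ 2) :
    opNorm (sinMatrix V V') ≤ 4 / 3 * (ρ / sval A r + ε / sval A r ^ 2) := by
  have hs : 0 ≤ sval A r := LinearMap.singularValues_nonneg _ _
  refine opNorm_sinMatrix_le (by positivity) fun k => ?_
  have isometry {W : Matrix (Fin n) (Fin r) 𝕜} (hW : Wᴴ * W = 1) :
      LinearMap.adjoint (toEuclideanLin W) ∘ₗ toEuclideanLin W = .id := by
    rw [← Matrix.toEuclideanLin_conjTranspose_eq_adjoint, ← Matrix.toLpLin_mul, hW,
      Matrix.toLpLin_one]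
  obtain ⟨v, hvV, u, huV', hv, hvu, hu, hw⟩ := exists_principal_vector
    (isometry hSVD.conjTranspose_mul_self) (isometry hSVD'.conjTranspose_mul_self)
    (k.2.trans_eq finrank_euclideanSpace_fin.symm)
  have hsin : Real.sin (principalAngle V V' k) = ‖u‖ := by
    rw [principalAngle, Real.sin_arccos, sval, Matrix.toLpLin_mul (q := 2),
      Matrix.toEuclideanLin_conjTranspose_eq_adjoint, Nat.add_sub_cancel, ← hu,
      Real.sqrt_sq (norm_nonneg _)]
  obtain ⟨r, rfl⟩ := Nat.exists_eq_add_of_le' hr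
  rw [hsin]
  exact norm_le_of_isLeadingRightSingularSubspace (finrank_range_toEuclideanLin A ▸ hrank)
    hSVD.isLeadingRightSingularSubspace
    (by simpa only [map_add] using hSVD'.isLeadingRightSingularSubspace) hA hB hp hρ hρs hε hεs hvV
    hv huV' hvu hw

end Perturbation

section Nets

open Metric

lemma card_le_of_isSeparated_one {E : Type*} [NormedAddCommGroup E] [NormedSpace ℝ E]
    [FiniteDimensional ℝ E] {s : Finset E} (hs : (s : Set E) ⊆ closedBall 0 2)
    (hsep : IsSeparated 1 (s : Set E)) : s.card ≤ 5 ^ finrank ℝ E := by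
  refine Besicovitch.card_le_of_separated s (fun c hc => by simpa using hs hc) ?_
  intro c hc d hd hcd
  have h : ENNReal.ofReal 1 < edist c d := by simpa using hsep hc hd hcd
  rw [edist_dist, ENNReal.ofReal_lt_ofReal_iff_of_nonneg zero_le_one, dist_eq_norm] at h
  exact h.le

lemma packingNumber_one_closedBall_two_le (E : Type*) [NormedAddCommGroup E] [NormedSpace ℝ E]
    [FiniteDimensional ℝ E] :
    packingNumber 1 (closedBall (0 : E) 2) ≤ (5 ^ finrank ℝ E : ℕ) := by
  refine iSup₂_le fun C hC => iSup_le fun hsep => ?_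
  by_contra! hlt
  obtain ⟨s, hsC, hs⟩ := Set.exists_subset_encard_eq (Order.add_one_le_of_lt hlt)
  have hfin : s.Finite := Set.finite_of_encard_eq_coe (k := 5 ^ finrank ℝ E + 1) (by simpa using hs)
  lift s to Finset E using hfin
  have hcard := card_le_of_isSeparated_one (hsC.trans hC) (hsep.subset hsC)
  rw [Set.encard_coe_eq_coe_finsetCard] at hs
  norm_cast at hs
  omega

variable {𝕜 E F : Type*} [RCLike 𝕜] [NormedAddCommGroup E] [InnerProductSpace 𝕜 E]
  [NormedAddCommGroup F] [InnerProductSpace 𝕜 F]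

variable (𝕜 E) in
lemma exists_isCover_one_closedBall_two [FiniteDimensional 𝕜 E] :
    ∃ N : Finset E, (N : Set E) ⊆ closedBall 0 2 ∧ IsCover 1 (closedBall 0 2) (N : Set E) ∧
      N.card ≤ 25 ^ finrank 𝕜 E := by
  let _ : NormedSpace ℝ E := NormedSpace.restrictScalars ℝ 𝕜 E
  have : IsScalarTower ℝ 𝕜 E := RestrictScalars.isScalarTower ℝ 𝕜 E
  have : FiniteDimensional ℝ E := FiniteDimensional.trans ℝ 𝕜 E
  have hle := packingNumber_one_closedBall_two_le E
  have htop : packingNumber 1 (closedBall (0 : E) 2) ≠ ⊤ := ne_top_of_le_ne_top (by simp) hle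
  rw [← encard_maximalSeparatedSet htop] at hle
  have hfin : (maximalSeparatedSet 1 (closedBall (0 : E) 2)).Finite :=
    Set.finite_of_encard_le_coe hle
  refine ⟨hfin.toFinset, by simpa using maximalSeparatedSet_subset,
    by simpa using isCover_maximalSeparatedSet htop, ?_⟩
  rw [hfin.encard_eq_coe_toFinset_card, Nat.cast_le] at hle
  calc hfin.toFinset.card ≤ 5 ^ finrank ℝ E := hle
    _ = (5 ^ finrank ℝ 𝕜) ^ finrank 𝕜 E := by rw [← pow_mul, finrank_mul_finrank]
    _ ≤ (5 ^ 2) ^ finrank 𝕜 E := by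
        gcongr
        · norm_num
        · exact RCLike.finrank_le_two 𝕜

lemma exists_mem_norm_sub_le_of_isCover {N : Set E} (hN : IsCover 1 (closedBall 0 2) N) {x : E}
    (hx : ‖x‖ ≤ 2) : ∃ y ∈ N, ‖x - y‖ ≤ 1 := by
  obtain ⟨y, hy, hxy⟩ := hN (show x ∈ closedBall 0 2 by simpa using hx)
  refine ⟨y, hy, ?_⟩
  rw [← dist_eq_norm]
  simpa [edist_dist] using hxy

lemma norm_le_of_isCover {N : Set F} (hN : IsCover 1 (closedBall 0 2) N) {y : F} {m : ℝ}
    (h : ∀ u ∈ N, RCLike.re ⟪u, y⟫_𝕜 ≤ m) : ‖y‖ ≤ m := by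
  set x : F := ((2 / ‖y‖ : ℝ) : 𝕜) • y with hx
  have hx2 : ‖x‖ ≤ 2 := by
    rw [hx, norm_smul, RCLike.norm_ofReal, abs_of_nonneg (by positivity)]
    rw [div_mul_eq_mul_div, mul_div_assoc]
    linarith [div_self_le_one ‖y‖]
  have hxy : RCLike.re ⟪x, y⟫_𝕜 = 2 * ‖y‖ := by
    rw [hx, inner_smul_left, RCLike.conj_ofReal, RCLike.re_ofReal_mul, inner_self_eq_norm_sq]
    rcases eq_or_ne ‖y‖ 0 with hy | hy
    · simp [hy]
    · field_simp
  obtain ⟨u, hu, hxu⟩ := exists_mem_norm_sub_le_of_isCover hN hx2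
  have hsub : RCLike.re ⟪x - u, y⟫_𝕜 ≤ 1 * ‖y‖ := (re_inner_le_norm _ _).trans (by gcongr)
  rw [inner_sub_left, map_sub, hxy] at hsub
  linarith [h u hu]

lemma opNorm_le_of_isCover {N : Set E} {N' : Set F} (hN : IsCover 1 (closedBall 0 2) N)
    (hN' : IsCover 1 (closedBall 0 2) N') (T : E →L[𝕜] F) {m : ℝ}
    (h : ∀ w ∈ N, ∀ u ∈ N', RCLike.re ⟪u, T w⟫_𝕜 ≤ m) : ‖T‖ ≤ m := by
  have hT : ∀ w ∈ N, ‖T w‖ ≤ m := fun w hw => norm_le_of_isCover hN' (h w hw)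
  have hball : ∀ x : E, ‖x‖ = 1 → ‖T x‖ ≤ (m + ‖T‖) / 2 := by
    intro x hx
    have hx2 : ‖(2 : 𝕜) • x‖ = 2 := by rw [norm_smul, RCLike.norm_ofNat, hx, mul_one]
    obtain ⟨w, hw, hxw⟩ := exists_mem_norm_sub_le_of_isCover hN hx2.le
    have : 2 * ‖T x‖ ≤ m + ‖T‖ :=
      calc 2 * ‖T x‖ = ‖T w + T ((2 : 𝕜) • x - w)‖ := by
            rw [← map_add, add_sub_cancel, map_smul, norm_smul, RCLike.norm_ofNat]
        _ ≤ ‖T w‖ + ‖T ((2 : 𝕜) • x - w)‖ := norm_add_le _ _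
        _ ≤ m + ‖T‖ * 1 := add_le_add (hT w hw) (T.le_of_opNorm_le_of_le le_rfl hxw)
        _ = m + ‖T‖ := by rw [mul_one]
    linarith
  have hm : 0 ≤ m := by
    obtain ⟨w, hw, -⟩ := exists_mem_norm_sub_le_of_isCover hN (x := 0) (by simp)
    exact (norm_nonneg _).trans (hT w hw)
  let _ : NormedSpace ℝ E := NormedSpace.restrictScalars ℝ 𝕜 E
  have := T.opNorm_le_of_unit_norm (by positivity) hball
  linarith

lemma measureReal_lt_opNorm_le [FiniteDimensional 𝕜 E] [FiniteDimensional 𝕜 F] {Ω : Type*}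
    [MeasurableSpace Ω] {μ : Measure Ω} [IsFiniteMeasure μ] (T : Ω → E →L[𝕜] F) {t δ : ℝ}
    (h : ∀ w u, ‖w‖ ≤ 2 → ‖u‖ ≤ 2 → μ.real {ω | t ≤ RCLike.re ⟪u, T ω w⟫_𝕜} ≤ δ) :
    μ.real {ω | t < ‖T ω‖} ≤ 25 ^ (finrank 𝕜 E + finrank 𝕜 F) * δ := by
  obtain ⟨N, hN2, hN, hNcard⟩ := exists_isCover_one_closedBall_two 𝕜 E
  obtain ⟨N', hN'2, hN', hN'card⟩ := exists_isCover_one_closedBall_two 𝕜 F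
  have hsub : {ω | t < ‖T ω‖} ⊆ ⋃ p ∈ N ×ˢ N', {ω | t ≤ RCLike.re ⟪p.2, T ω p.1⟫_𝕜} := by
    intro ω hω
    contrapose! hω
    simp only [Set.mem_iUnion, Finset.mem_product, Set.mem_ofPred_eq, exists_prop, Prod.exists,
      not_exists, not_and, not_le] at hω
    simpa using opNorm_le_of_isCover hN hN' (T ω) fun w hw u hu => (hω w u ⟨hw, hu⟩).le
  have hδ : 0 ≤ δ := measureReal_nonneg.trans (h 0 0 (by simp) (by simp))
  calc μ.real {ω | t < ‖T ω‖}
      ≤ ∑ p ∈ N ×ˢ N', μ.real {ω | t ≤ RCLike.re ⟪p.2, T ω p.1⟫_𝕜} :=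
        (measureReal_mono hsub (measure_ne_top _ _)).trans (measureReal_biUnion_finset_le _ _)
    _ ≤ (N ×ˢ N').card • δ := Finset.sum_le_card_nsmul _ _ _ fun p hp => by
        obtain ⟨hw, hu⟩ := Finset.mem_product.1 hp
        exact h p.1 p.2 (by simpa using hN2 hw) (by simpa using hN'2 hu)
    _ ≤ 25 ^ (finrank 𝕜 E + finrank 𝕜 F) * δ := by
        rw [nsmul_eq_mul, Finset.card_product, pow_add]
        gcongr
        exact_mod_cast Nat.mul_le_mul hNcard hN'card

end Nets

section ExponentialInequalities

lemma exp_le_one_add_add_sq_mul_exp_abs (x : ℝ) :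
    Real.exp x ≤ 1 + x + x ^ 2 * Real.exp |x| := by
  have hsq : x ^ 2 ≤ x ^ 2 * Real.exp |x| :=
    le_mul_of_one_le_right (sq_nonneg x) (Real.one_le_exp (abs_nonneg x))
  rcases le_or_gt |x| 1 with h | h
  · linarith [(abs_le.1 (Real.abs_exp_sub_one_sub_id_le h)).2]
  · rcases lt_abs.1 h with h | h
    · rw [abs_of_pos (by linarith)]
      have : 1 * Real.exp x ≤ x ^ 2 * Real.exp x := by
        gcongr
        nlinarith
      linarith
    · have : Real.exp x ≤ 1 := Real.exp_le_one_iff.2 (by linarith)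
      nlinarith

lemma exp_le_id_add_exp_sq (x : ℝ) : Real.exp x ≤ x + Real.exp (x ^ 2) := by
  have hsq := Real.add_one_le_exp (x ^ 2)
  rcases le_or_gt |x| 1 with h | h
  · linarith [(abs_le.1 (Real.abs_exp_sub_one_sub_id_le h)).2]
  · rcases lt_abs.1 h with h | h
    · have : Real.exp x ≤ Real.exp (x ^ 2) := Real.exp_le_exp.2 (by nlinarith)
      linarith
    · have : Real.exp x ≤ 1 := Real.exp_le_one_iff.2 (by linarith)
      nlinarith

lemma exp_mul_le_of_mem_Icc {θ : ℝ} (h0 : 0 ≤ θ) (h1 : θ ≤ 1) (a : ℝ) :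
    Real.exp (θ * a) ≤ 1 - θ + θ * Real.exp a := by
  have := convexOn_exp.2 (Set.mem_univ 0) (Set.mem_univ a) (sub_nonneg.2 h1) h0 (by ring)
  simpa using this

lemma exp_le_average_of_le_average {a b c : ℝ} (h : c ≤ (a + b) / 2) :
    Real.exp c ≤ (Real.exp a + Real.exp b) / 2 := by
  have := convexOn_exp.2 (Set.mem_univ a) (Set.mem_univ b) one_half_pos.le one_half_pos.le
    (add_halves 1)
  simp only [smul_eq_mul] at this
  calc Real.exp c ≤ Real.exp (1 / 2 * a + 1 / 2 * b) := Real.exp_le_exp.2 (by linarith)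
    _ ≤ (Real.exp a + Real.exp b) / 2 := by linarith

lemma exp_mul_le_exp_mul_average {v : ℝ} (hv : 0 < v) (t y : ℝ) :
    Real.exp (t * y) ≤ Real.exp (v * t ^ 2 / 2) * ((1 + Real.exp (y ^ 2 / v)) / 2) := by
  have hsq : 2 * (t * y) ≤ v * t ^ 2 + y ^ 2 / v := by
    have : v * t ^ 2 + y ^ 2 / v - 2 * (t * y) = (v * t - y) ^ 2 / v := by
      field_simp
      ring
    linarith [div_nonneg (sq_nonneg (v * t - y)) hv.le]
  calc Real.exp (t * y) ≤ Real.exp (v * t ^ 2 / 2 + y ^ 2 / v / 2) :=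
        Real.exp_le_exp.2 (by linarith)
    _ = Real.exp (v * t ^ 2 / 2) * Real.exp (y ^ 2 / v / 2) := Real.exp_add _ _
    _ ≤ Real.exp (v * t ^ 2 / 2) * ((1 + Real.exp (y ^ 2 / v)) / 2) := by
        gcongr
        simpa using exp_le_average_of_le_average (a := 0) (b := y ^ 2 / v) (by simp)

lemma exp_mul_le_of_mul_sq_le_one {v : ℝ} (hv : 0 < v) {t : ℝ} (ht : v * t ^ 2 ≤ 1) (y : ℝ) :
    Real.exp (t * y) ≤ t * y + (1 - v * t ^ 2 + v * t ^ 2 * Real.exp (y ^ 2 / v)) := by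
  have hsq : v * t ^ 2 * (y ^ 2 / v) = (t * y) ^ 2 := by field_simp
  have hle := exp_mul_le_of_mem_Icc (by positivity) ht (y ^ 2 / v)
  rw [hsq] at hle
  linarith [exp_le_id_add_exp_sq (t * y)]

lemma exp_mul_sub_le {M x m t : ℝ} (hM : 0 < M) (hx : 0 ≤ x) (hm : 0 ≤ m) (hmM : m ≤ M)
    (ht : |t| * M ≤ 1 / 2) :
    Real.exp (t * (x - m)) ≤ 1 + t * (x - m) + 24 * M ^ 2 * t ^ 2 * Real.exp (x / M) := by
  obtain ⟨a, ha, rfl⟩ : ∃ a, 0 ≤ a ∧ x = M * a := ⟨x / M, by positivity, by field_simp⟩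
  rw [mul_div_cancel_left₀ a hM.ne']
  have hsub : |M * a - m| ≤ M * (a + 1) := abs_le.2 ⟨by nlinarith, by nlinarith⟩
  have habs : |t * (M * a - m)| ≤ (a + 1) / 2 :=
    calc |t * (M * a - m)| ≤ |t| * (M * (a + 1)) := by rw [abs_mul]; gcongr
      _ = |t| * M * (a + 1) := by ring
      _ ≤ 1 / 2 * (a + 1) := by gcongr
      _ = (a + 1) / 2 := by ring
  have hsq : (t * (M * a - m)) ^ 2 ≤ t ^ 2 * M ^ 2 * (a + 1) ^ 2 :=
    calc (t * (M * a - m)) ^ 2 = t ^ 2 * |M * a - m| ^ 2 := by rw [sq_abs]; ring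
      _ ≤ t ^ 2 * (M * (a + 1)) ^ 2 := by gcongr
      _ = t ^ 2 * M ^ 2 * (a + 1) ^ 2 := by ring
  have hpow : (a + 1) ^ 2 ≤ 8 * Real.exp ((a + 1) / 2) := by
    have := Real.quadratic_le_exp_of_nonneg (x := (a + 1) / 2) (by positivity)
    nlinarith
  have hexp : Real.exp ((a + 1) / 2) * Real.exp ((a + 1) / 2) ≤ 3 * Real.exp a := by
    rw [← Real.exp_add, add_halves, Real.exp_add, mul_comm]
    gcongr
    exact Real.exp_one_lt_d9.le.trans (by norm_num)
  have hsecond : (t * (M * a - m)) ^ 2 * Real.exp |t * (M * a - m)| ≤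
      24 * M ^ 2 * t ^ 2 * Real.exp a :=
    calc _ ≤ t ^ 2 * M ^ 2 * (8 * Real.exp ((a + 1) / 2)) * Real.exp ((a + 1) / 2) := by
          gcongr
          exact hsq.trans (by gcongr)
      _ = 8 * t ^ 2 * M ^ 2 * (Real.exp ((a + 1) / 2) * Real.exp ((a + 1) / 2)) := by ring
      _ ≤ 8 * t ^ 2 * M ^ 2 * (3 * Real.exp a) := by gcongr
      _ = 24 * M ^ 2 * t ^ 2 * Real.exp a := by ring
  linarith [exp_le_one_add_add_sq_mul_exp_abs (t * (M * a - m))]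

end ExponentialInequalities

section ExponentialMoments

variable {Ω : Type*} [MeasurableSpace Ω] {μ : Measure Ω}

lemma integrable_exp_of_lintegral_exp_le {f : Ω → ℝ} (hf : AEMeasurable f μ) {c : ℝ≥0}
    (h : ∫⁻ ω, ENNReal.ofReal (Real.exp (f ω)) ∂μ ≤ c) :
    Integrable (fun ω => Real.exp (f ω)) μ :=
  (lintegral_ofReal_ne_top_iff_integrable hf.exp.aestronglyMeasurable
    (ae_of_all _ fun _ => Real.exp_nonneg _)).1 (ne_top_of_le_ne_top ENNReal.coe_ne_top h)

lemma integral_exp_le_of_lintegral_exp_le {f : Ω → ℝ} (hf : AEMeasurable f μ) {c : ℝ≥0}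
    (h : ∫⁻ ω, ENNReal.ofReal (Real.exp (f ω)) ∂μ ≤ c) : ∫ ω, Real.exp (f ω) ∂μ ≤ c := by
  rw [integral_eq_lintegral_of_nonneg_ae (ae_of_all _ fun _ => Real.exp_nonneg _)
    hf.exp.aestronglyMeasurable]
  exact ENNReal.toReal_le_coe_of_le_coe h

lemma lintegral_exp_le_of_le_average {f g h : Ω → ℝ} (hf : AEMeasurable f μ) {c : ℝ≥0∞}
    (hfc : ∫⁻ ω, ENNReal.ofReal (Real.exp (f ω)) ∂μ ≤ c)
    (hgc : ∫⁻ ω, ENNReal.ofReal (Real.exp (g ω)) ∂μ ≤ c) (hle : ∀ ω, h ω ≤ (f ω + g ω) / 2) :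
    ∫⁻ ω, ENNReal.ofReal (Real.exp (h ω)) ∂μ ≤ c := by
  have hpt : ∀ ω, ENNReal.ofReal (Real.exp (h ω)) ≤
      2⁻¹ * (ENNReal.ofReal (Real.exp (f ω)) + ENNReal.ofReal (Real.exp (g ω))) := by
    intro ω
    rw [← ENNReal.ofReal_add (Real.exp_nonneg _) (Real.exp_nonneg _), mul_comm,
      ← div_eq_mul_inv, ← ENNReal.ofReal_ofNat 2, ← ENNReal.ofReal_div_of_pos two_pos]
    exact ENNReal.ofReal_le_ofReal (exp_le_average_of_le_average (hle ω))
  calc ∫⁻ ω, ENNReal.ofReal (Real.exp (h ω)) ∂μ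
      ≤ 2⁻¹ * (∫⁻ ω, ENNReal.ofReal (Real.exp (f ω)) ∂μ +
          ∫⁻ ω, ENNReal.ofReal (Real.exp (g ω)) ∂μ) := by
        rw [← lintegral_add_left' hf.exp.ennreal_ofReal, ← lintegral_const_mul' _ _ (by simp)]
        exact lintegral_mono hpt
    _ ≤ 2⁻¹ * (c + c) := by gcongr
    _ = c := by rw [← two_mul, ← mul_assoc, ENNReal.inv_mul_cancel two_ne_zero (by simp), one_mul]

variable [IsProbabilityMeasure μ]

section Subgaussian

variable {Y : Ω → ℝ} (hY : Integrable Y μ) {v : ℝ≥0}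
  (h : ∫⁻ ω, ENNReal.ofReal (Real.exp (Y ω ^ 2 / v)) ∂μ ≤ (2 : ℝ≥0))

include hY h

lemma mgf_le_of_mul_sq_le_one (hY0 : ∫ ω, Y ω ∂μ = 0) (hv : 0 < v) {t : ℝ} (ht : v * t ^ 2 ≤ 1)
    (hexp : Integrable (fun ω => Real.exp (t * Y ω)) μ) : mgf Y μ t ≤ Real.exp (v * t ^ 2) := by
  have hYm : AEMeasurable (fun ω => Y ω ^ 2 / v) μ := (hY.aemeasurable.pow_const 2).div_const _
  have hG := integrable_exp_of_lintegral_exp_le hYm h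
  have hG2 : ∫ ω, Real.exp (Y ω ^ 2 / v) ∂μ ≤ 2 := integral_exp_le_of_lintegral_exp_le hYm h
  have hi : Integrable (fun ω => 1 - v * t ^ 2 + v * t ^ 2 * Real.exp (Y ω ^ 2 / v)) μ :=
    (integrable_const _).add (hG.const_mul _)
  calc mgf Y μ t
      ≤ ∫ ω, (t * Y ω + (1 - v * t ^ 2 + v * t ^ 2 * Real.exp (Y ω ^ 2 / v))) ∂μ :=
        integral_mono hexp ((hY.const_mul t).add hi) fun ω => exp_mul_le_of_mul_sq_le_one hv ht _
    _ = 1 - v * t ^ 2 + v * t ^ 2 * ∫ ω, Real.exp (Y ω ^ 2 / v) ∂μ := by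
        rw [integral_add (hY.const_mul t) hi, integral_const_mul, hY0,
          integral_add (integrable_const _) (hG.const_mul _), integral_const_mul]
        simp
    _ ≤ 1 - v * t ^ 2 + v * t ^ 2 * 2 := by gcongr
    _ = v * t ^ 2 + 1 := by ring
    _ ≤ Real.exp (v * t ^ 2) := Real.add_one_le_exp _

lemma integrable_exp_mul_and_mgf_le (hv : 0 < v) (t : ℝ) :
    Integrable (fun ω => Real.exp (t * Y ω)) μ ∧
      mgf Y μ t ≤ Real.exp (v * t ^ 2 / 2) * (3 / 2) := by
  have hYm : AEMeasurable (fun ω => Y ω ^ 2 / v) μ := (hY.aemeasurable.pow_const 2).div_const _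
  have hG := integrable_exp_of_lintegral_exp_le hYm h
  have hG2 : ∫ ω, Real.exp (Y ω ^ 2 / v) ∂μ ≤ 2 := integral_exp_le_of_lintegral_exp_le hYm h
  have hle := fun ω => exp_mul_le_exp_mul_average hv t (Y ω)
  have hi := (((integrable_const 1).add hG).div_const 2).const_mul (Real.exp (v * t ^ 2 / 2))
  have hexp : Integrable (fun ω => Real.exp (t * Y ω)) μ :=
    hi.mono' (hY.aemeasurable.const_mul t).exp.aestronglyMeasurable <| ae_of_all _ fun ω => by
      rw [Real.norm_of_nonneg (Real.exp_nonneg _)]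
      exact hle ω
  refine ⟨hexp, ?_⟩
  calc mgf Y μ t
      ≤ ∫ ω, Real.exp (v * t ^ 2 / 2) * ((1 + Real.exp (Y ω ^ 2 / v)) / 2) ∂μ :=
        integral_mono hexp hi hle
    _ = Real.exp (v * t ^ 2 / 2) * ((1 + ∫ ω, Real.exp (Y ω ^ 2 / v) ∂μ) / 2) := by
        rw [integral_const_mul, integral_div, integral_add (integrable_const 1) hG]
        simp
    _ ≤ Real.exp (v * t ^ 2 / 2) * (3 / 2) := by
        gcongr
        linarith

lemma hasSubgaussianMGF_of_lintegral_exp_sq_div_le (hY0 : ∫ ω, Y ω ∂μ = 0) (hv : 0 < v) :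
    HasSubgaussianMGF Y (2 * v) μ := by
  have hexp := integrable_exp_mul_and_mgf_le hY h hv
  refine ⟨fun t => (hexp t).1, fun t => ?_⟩
  rw [NNReal.coe_mul, NNReal.coe_ofNat, mul_assoc, mul_div_cancel_left₀ _ two_ne_zero]
  rcases le_or_gt ((v : ℝ) * t ^ 2) 1 with ht | ht
  · exact mgf_le_of_mul_sq_le_one hY h hY0 hv ht (hexp t).1
  · calc mgf Y μ t ≤ Real.exp (v * t ^ 2 / 2) * (3 / 2) := (hexp t).2
      _ ≤ Real.exp (v * t ^ 2 / 2) * Real.exp (v * t ^ 2 / 2) := by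
          gcongr
          linarith [Real.add_one_le_exp (v * t ^ 2 / 2)]
      _ = Real.exp (v * t ^ 2) := by rw [← Real.exp_add, add_halves]

end Subgaussian

section Subexponential

variable {ξ : Ω → ℝ} (hξ : AEMeasurable ξ μ) (hξ0 : ∀ ω, 0 ≤ ξ ω) {M : ℝ} (hM : 0 < M)
  (h : ∫⁻ ω, ENNReal.ofReal (Real.exp (ξ ω / M)) ∂μ ≤ (2 : ℝ≥0))

include hξ hξ0 hM h

lemma integrable_and_integral_le_of_lintegral_exp_div_le : Integrable ξ μ ∧ ∫ ω, ξ ω ∂μ ≤ M := by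
  have hG := integrable_exp_of_lintegral_exp_le (hξ.div_const M) h
  have hG2 : ∫ ω, Real.exp (ξ ω / M) ∂μ ≤ 2 :=
    integral_exp_le_of_lintegral_exp_le (hξ.div_const M) h
  have hle : ∀ ω, ξ ω ≤ M * (Real.exp (ξ ω / M) - 1) := fun ω =>
    calc ξ ω = M * (ξ ω / M) := by field_simp
      _ ≤ M * (Real.exp (ξ ω / M) - 1) := by
          gcongr
          linarith [Real.add_one_le_exp (ξ ω / M)]
  have hi := (hG.sub (integrable_const 1)).const_mul M
  have hξi : Integrable ξ μ := hi.mono' hξ.aestronglyMeasurable <| ae_of_all _ fun ω => by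
    rw [Real.norm_of_nonneg (hξ0 ω)]
    exact hle ω
  refine ⟨hξi, ?_⟩
  calc ∫ ω, ξ ω ∂μ ≤ ∫ ω, M * (Real.exp (ξ ω / M) - 1) ∂μ := integral_mono hξi hi hle
    _ = M * (∫ ω, Real.exp (ξ ω / M) ∂μ - 1) := by
        rw [integral_const_mul, integral_sub hG (integrable_const 1)]
        simp
    _ ≤ M * 1 := by
        gcongr
        linarith
    _ = M := mul_one M

lemma integrable_exp_and_mgf_sub_integral_le {t : ℝ} (ht : |t| * M ≤ 1 / 2) :
    Integrable (fun ω => Real.exp (t * (ξ ω - ∫ ω, ξ ω ∂μ))) μ ∧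
      mgf (fun ω => ξ ω - ∫ ω, ξ ω ∂μ) μ t ≤ Real.exp (48 * M ^ 2 * t ^ 2) := by
  obtain ⟨hξi, hmM⟩ := integrable_and_integral_le_of_lintegral_exp_div_le hξ hξ0 hM h
  have hG := integrable_exp_of_lintegral_exp_le (hξ.div_const M) h
  have hG2 : ∫ ω, Real.exp (ξ ω / M) ∂μ ≤ 2 :=
    integral_exp_le_of_lintegral_exp_le (hξ.div_const M) h
  set m := ∫ ω, ξ ω ∂μ with hm
  have hle := fun ω => exp_mul_sub_le hM (hξ0 ω) (integral_nonneg hξ0) hmM ht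
  have hdi : Integrable (fun ω => ξ ω - m) μ := hξi.sub (integrable_const m)
  have hi1 : Integrable (fun ω => 1 + t * (ξ ω - m)) μ :=
    (integrable_const 1).add (hdi.const_mul t)
  have hi2 := hG.const_mul (24 * M ^ 2 * t ^ 2)
  have hexp : Integrable (fun ω => Real.exp (t * (ξ ω - m))) μ :=
    (hi1.add hi2).mono' ((hξ.sub_const m).const_mul t).exp.aestronglyMeasurable <|
      ae_of_all _ fun ω => by
        rw [Real.norm_of_nonneg (Real.exp_nonneg _)]
        exact hle ω
  refine ⟨hexp, ?_⟩
  calc mgf (fun ω => ξ ω - m) μ t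
      ≤ ∫ ω, (1 + t * (ξ ω - m) + 24 * M ^ 2 * t ^ 2 * Real.exp (ξ ω / M)) ∂μ :=
        integral_mono hexp (hi1.add hi2) hle
    _ = 1 + 24 * M ^ 2 * t ^ 2 * ∫ ω, Real.exp (ξ ω / M) ∂μ := by
        rw [integral_add hi1 hi2, integral_add (integrable_const 1) (hdi.const_mul t),
          integral_const_mul, integral_const_mul, integral_sub hξi (integrable_const m), ← hm]
        simp
    _ ≤ 1 + 24 * M ^ 2 * t ^ 2 * 2 := by gcongr
    _ = 48 * M ^ 2 * t ^ 2 + 1 := by ring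
    _ ≤ Real.exp (48 * M ^ 2 * t ^ 2) := Real.add_one_le_exp _

end Subexponential

lemma measureReal_le_abs_le_of_mgf_le {X : Ω → ℝ} {v b : ℝ} (hv : 0 < v) (hb : 0 ≤ b)
    (hX : ∀ t, |t| ≤ b → Integrable (fun ω => Real.exp (t * X ω)) μ ∧
      mgf X μ t ≤ Real.exp (v * t ^ 2)) {s : ℝ} (hs : 0 ≤ s) :
    μ.real {ω | s ≤ |X ω|} ≤ 2 * Real.exp (-min (s ^ 2 / (4 * v)) (b * s / 2)) := by
  obtain ⟨t, ht0, htb, ht⟩ : ∃ t, 0 ≤ t ∧ t ≤ b ∧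
      -t * s + v * t ^ 2 ≤ -min (s ^ 2 / (4 * v)) (b * s / 2) := by
    rcases le_total (s / (2 * v)) b with h | h
    · refine ⟨s / (2 * v), by positivity, h, ?_⟩
      calc -(s / (2 * v)) * s + v * (s / (2 * v)) ^ 2 = -(s ^ 2 / (4 * v)) := by field
        _ ≤ -min (s ^ 2 / (4 * v)) (b * s / 2) := neg_le_neg (min_le_left _ _)
    · refine ⟨b, hb, le_rfl, ?_⟩
      rw [le_div_iff₀ (by positivity)] at h
      calc -b * s + v * b ^ 2 ≤ -(b * s / 2) := by nlinarith
        _ ≤ -min (s ^ 2 / (4 * v)) (b * s / 2) := neg_le_neg (min_le_right _ _)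
  have hexp : Real.exp (-t * s) * Real.exp (v * t ^ 2) ≤
      Real.exp (-min (s ^ 2 / (4 * v)) (b * s / 2)) := by
    rw [← Real.exp_add]
    exact Real.exp_le_exp.2 ht
  obtain ⟨hi, hmgf⟩ := hX t (by rwa [abs_of_nonneg ht0])
  obtain ⟨hi', hmgf'⟩ := hX (-t) (by rwa [abs_neg, abs_of_nonneg ht0])
  have hupper : μ.real {ω | s ≤ X ω} ≤ Real.exp (-min (s ^ 2 / (4 * v)) (b * s / 2)) :=
    calc μ.real {ω | s ≤ X ω} ≤ Real.exp (-t * s) * mgf X μ t :=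
          measure_ge_le_exp_mul_mgf s ht0 hi
      _ ≤ Real.exp (-t * s) * Real.exp (v * t ^ 2) := by gcongr
      _ ≤ _ := hexp
  have hlower : μ.real {ω | X ω ≤ -s} ≤ Real.exp (-min (s ^ 2 / (4 * v)) (b * s / 2)) :=
    calc μ.real {ω | X ω ≤ -s} ≤ Real.exp (- -t * -s) * mgf X μ (-t) :=
          measure_le_le_exp_mul_mgf (-s) (neg_nonpos.2 ht0) hi'
      _ ≤ Real.exp (- -t * -s) * Real.exp (v * (-t) ^ 2) := by gcongr
      _ = Real.exp (-t * s) * Real.exp (v * t ^ 2) := by ring_nf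
      _ ≤ _ := hexp
  calc μ.real {ω | s ≤ |X ω|} ≤ μ.real ({ω | s ≤ X ω} ∪ {ω | X ω ≤ -s}) :=
        measureReal_mono (fun ω (hω : s ≤ |X ω|) => (le_abs.1 hω).imp_right le_neg_of_le_neg)
    _ ≤ μ.real {ω | s ≤ X ω} + μ.real {ω | X ω ≤ -s} := measureReal_union_le _ _
    _ ≤ 2 * Real.exp (-min (s ^ 2 / (4 * v)) (b * s / 2)) := by linarith

lemma measureReal_le_abs_sum_sub_integral_le {ι : Type*} [Fintype ι] [Nonempty ι]
    {ξ : ι → Ω → ℝ} (hξ : ∀ i, Measurable (ξ i)) (hξ0 : ∀ i ω, 0 ≤ ξ i ω) (hind : iIndepFun ξ μ)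
    {M : ℝ} (hM : 0 < M)
    (h : ∀ i, ∫⁻ ω, ENNReal.ofReal (Real.exp (ξ i ω / M)) ∂μ ≤ (2 : ℝ≥0)) {s : ℝ} (hs : 0 ≤ s) :
    μ.real {ω | s ≤ |∑ i, (ξ i ω - ∫ ω, ξ i ω ∂μ)|} ≤
      2 * Real.exp (-min (s ^ 2 / (192 * Fintype.card ι * M ^ 2)) (s / (4 * M))) := by
  set η : ι → Ω → ℝ := fun i ω => ξ i ω - ∫ ω, ξ i ω ∂μ
  have hηm : ∀ i, Measurable (η i) := fun i => (hξ i).sub_const _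
  have hηind : iIndepFun η μ :=
    hind.comp (fun i x => x - ∫ ω, ξ i ω ∂μ) fun _ => measurable_id.sub_const _
  have hmgf : ∀ t, |t| ≤ 1 / (2 * M) → Integrable (fun ω => Real.exp (t * (∑ i, η i) ω)) μ ∧
      mgf (∑ i, η i) μ t ≤ Real.exp (48 * Fintype.card ι * M ^ 2 * t ^ 2) := by
    intro t ht
    have htM : |t| * M ≤ 1 / 2 := by
      rw [le_div_iff₀ (by positivity)] at ht
      linarith
    have hη := fun i =>
      integrable_exp_and_mgf_sub_integral_le (hξ i).aemeasurable (hξ0 i) hM (h i) htM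
    refine ⟨hηind.integrable_exp_mul_sum hηm fun i _ => (hη i).1, ?_⟩
    calc mgf (∑ i, η i) μ t = ∏ i, mgf (η i) μ t := hηind.mgf_sum hηm _
      _ ≤ ∏ _i : ι, Real.exp (48 * M ^ 2 * t ^ 2) :=
          Finset.prod_le_prod (fun _ _ => mgf_nonneg) fun i _ => (hη i).2
      _ = Real.exp (48 * Fintype.card ι * M ^ 2 * t ^ 2) := by
          rw [Finset.prod_const, Finset.card_univ, ← Real.exp_nat_mul]
          ring_nf
  have : (0 : ℝ) < Fintype.card ι := Nat.cast_pos.2 Fintype.card_pos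
  have hsq : s ^ 2 / (192 * Fintype.card ι * M ^ 2) =
      s ^ 2 / (4 * (48 * Fintype.card ι * M ^ 2)) := by ring
  have hlin : s / (4 * M) = 1 / (2 * M) * s / 2 := by ring
  rw [hsq, hlin]
  simpa only [Finset.sum_apply] using
    measureReal_le_abs_le_of_mgf_le (by positivity) (by positivity) hmgf hs

end ExponentialMoments

section RandomVectors

lemma add_sq_div_four_mul_le {d : ℝ} (hd : 0 < d) (a b : ℝ) :
    (a + b) ^ 2 / (4 * d) ≤ (a ^ 2 / d + b ^ 2 / d) / 2 := by
  rw [← add_div, div_div, div_le_div_iff₀ (by positivity) (by positivity)]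
  nlinarith [add_sq_le (a := a) (b := b)]

variable {𝕜 : Type*} [RCLike 𝕜] {p : ℕ}

lemma re_inner_toLp (z : Fin p → 𝕜) (x : EuclideanSpace 𝕜 (Fin p)) :
    RCLike.re ⟪WithLp.toLp 2 z, x⟫_𝕜 =
      (fun i => RCLike.re (z i)) ⬝ᵥ (fun i => RCLike.re (x i)) +
        (fun i => RCLike.im (z i)) ⬝ᵥ (fun i => RCLike.im (x i)) := by
  simp only [PiLp.inner_apply, RCLike.inner_apply', map_sum, RCLike.mul_re, RCLike.conj_re,
    RCLike.conj_im, dotProduct, ← Finset.sum_add_distrib]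
  exact Finset.sum_congr rfl fun _ _ => by ring

lemma im_inner_toLp (z : Fin p → 𝕜) (x : EuclideanSpace 𝕜 (Fin p)) :
    RCLike.im ⟪WithLp.toLp 2 z, x⟫_𝕜 =
      (fun i => RCLike.re (z i)) ⬝ᵥ (fun i => RCLike.im (x i)) -
        (fun i => RCLike.im (z i)) ⬝ᵥ (fun i => RCLike.re (x i)) := by
  simp only [PiLp.inner_apply, RCLike.inner_apply', map_sum, RCLike.mul_im, RCLike.conj_re,
    RCLike.conj_im, dotProduct, ← Finset.sum_sub_distrib]
  exact Finset.sum_congr rfl fun _ _ => by ring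

lemma norm_toLp_le_of_abs_le {x : EuclideanSpace 𝕜 (Fin p)} {a : Fin p → ℝ}
    (h : ∀ i, |a i| ≤ ‖x i‖) : ‖WithLp.toLp 2 a‖ ≤ ‖x‖ := by
  rw [EuclideanSpace.norm_eq, EuclideanSpace.norm_eq]
  gcongr with i
  exact h i

variable {Ω : Type*} [MeasurableSpace Ω] {μ : Measure Ω} {y : Ω → Fin p → 𝕜}

section Isotropic

variable (h : IsIsotropic y μ)

include h

lemma IsIsotropic.memLp_inner (x : EuclideanSpace 𝕜 (Fin p)) :
    MemLp (fun ω => ⟪WithLp.toLp 2 (y ω), x⟫_𝕜) 2 μ := by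
  simp only [PiLp.inner_apply, RCLike.inner_apply]
  exact memLp_finsetSum _ fun i _ => (h.1 i).star.const_mul (x i)

lemma IsIsotropic.integral_norm_inner_sq (x : EuclideanSpace 𝕜 (Fin p)) :
    ∫ ω, ‖⟪WithLp.toLp 2 (y ω), x⟫_𝕜‖ ^ 2 ∂μ = ‖x‖ ^ 2 := by
  have hint : ∀ i j, Integrable (fun ω => star (x i) * x j * (y ω i * star (y ω j))) μ :=
    fun i j => ((h.1 i).integrable_mul (h.1 j).star).const_mul _
  have hexpand : ∀ ω, ((‖⟪WithLp.toLp 2 (y ω), x⟫_𝕜‖ ^ 2 : ℝ) : 𝕜) =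
      ∑ i, ∑ j, star (x i) * x j * (y ω i * star (y ω j)) := by
    intro ω
    rw [RCLike.ofReal_pow, ← RCLike.conj_mul, PiLp.inner_apply, map_sum, Finset.sum_mul_sum]
    refine Finset.sum_congr rfl fun i _ => Finset.sum_congr rfl fun j _ => ?_
    simp only [RCLike.inner_apply, map_mul, RCLike.conj_conj, RCLike.star_def]
    ring
  have hcast : ((∫ ω, ‖⟪WithLp.toLp 2 (y ω), x⟫_𝕜‖ ^ 2 ∂μ : ℝ) : 𝕜) = ((‖x‖ ^ 2 : ℝ) : 𝕜) :=
    calc _ = ∫ ω, ∑ i, ∑ j, star (x i) * x j * (y ω i * star (y ω j)) ∂μ := by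
          simp only [← integral_ofReal, hexpand]
      _ = ∑ i, ∑ j, star (x i) * x j * (1 : Matrix (Fin p) (Fin p) 𝕜) i j := by
          simp only [integral_finsetSum _ fun i _ => integrable_finsetSum _ fun j _ => hint i j,
            integral_finsetSum _ fun j _ => hint _ j, integral_const_mul, h.2]
      _ = ∑ i, star (x i) * x i := by simp [Matrix.one_apply]
      _ = ((‖x‖ ^ 2 : ℝ) : 𝕜) := by
          simp only [EuclideanSpace.norm_sq_eq, RCLike.ofReal_sum, RCLike.ofReal_pow,
            ← RCLike.conj_mul, RCLike.star_def]
  exact_mod_cast hcast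

lemma IsIsotropic.eLpNorm_inner (x : EuclideanSpace 𝕜 (Fin p)) :
    eLpNorm (fun ω => ⟪WithLp.toLp 2 (y ω), x⟫_𝕜) 2 μ = ENNReal.ofReal ‖x‖ := by
  rw [(h.memLp_inner x).eLpNorm_eq_integral_rpow_norm two_ne_zero ENNReal.ofNat_ne_top]
  simp only [ENNReal.toReal_ofNat, Real.rpow_ofNat, h.integral_norm_inner_sq x]
  exact_mod_cast congrArg ENNReal.ofReal (Real.pow_rpow_inv_natCast (norm_nonneg x) two_ne_zero)

lemma IsIsotropic.eLpNorm_inner_ofReal (a : Fin p → ℝ) :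
    eLpNorm (fun ω => ⟪WithLp.toLp 2 (y ω), WithLp.toLp 2 fun i => (a i : 𝕜)⟫_𝕜) 2 μ =
      ENNReal.ofReal ‖WithLp.toLp 2 a‖ := by
  rw [h.eLpNorm_inner]
  simp only [EuclideanSpace.norm_eq, RCLike.norm_ofReal, Real.norm_eq_abs]

lemma IsIsotropic.eLpNorm_re_dotProduct_le (a : Fin p → ℝ) :
    eLpNorm (fun ω => (fun i => RCLike.re (y ω i)) ⬝ᵥ a) 2 μ ≤
      ENNReal.ofReal ‖WithLp.toLp 2 a‖ := by
  rw [← h.eLpNorm_inner_ofReal]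
  refine eLpNorm_mono fun ω => (RCLike.abs_re_le_norm _).trans_eq' ?_
  simp [re_inner_toLp, dotProduct]

lemma IsIsotropic.eLpNorm_im_dotProduct_le (a : Fin p → ℝ) :
    eLpNorm (fun ω => (fun i => RCLike.im (y ω i)) ⬝ᵥ a) 2 μ ≤
      ENNReal.ofReal ‖WithLp.toLp 2 a‖ := by
  rw [← h.eLpNorm_inner_ofReal]
  refine eLpNorm_mono fun ω => (RCLike.abs_im_le_norm _).trans_eq' ?_
  simp [im_inner_toLp, dotProduct]

end Isotropic

lemma lintegral_exp_sq_div_le_of_psiTwoNorm_lt {f : Ω → ℝ} {K : ℝ}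
    (h : psiTwoNorm f μ < ENNReal.ofReal K) :
    ∫⁻ ω, ENNReal.ofReal (Real.exp (f ω ^ 2 / K ^ 2)) ∂μ ≤ 2 := by
  simp only [psiTwoNorm, iInf_lt_iff] at h
  obtain ⟨t, ⟨ht0, ht⟩, htK⟩ := h
  have htK' : t < K := (ENNReal.ofReal_lt_ofReal_iff_of_nonneg ht0.le).1 htK
  refine (lintegral_mono fun ω => ?_).trans ht
  rw [sq_abs]
  gcongr

section Subgaussian

variable {τ : ℝ}

lemma IsSubgaussianReal.aemeasurable_dotProduct {y : Ω → Fin p → ℝ}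
    (h : IsSubgaussianReal τ y μ) (a : Fin p → ℝ) : AEMeasurable (fun ω => y ω ⬝ᵥ a) μ :=
  Finset.aemeasurable_fun_sum _ fun i _ => (h.1 i).aestronglyMeasurable.aemeasurable.mul_const _

lemma IsSubgaussianReal.integral_dotProduct [IsFiniteMeasure μ] {y : Ω → Fin p → ℝ}
    (h : IsSubgaussianReal τ y μ) (a : Fin p → ℝ) : ∫ ω, y ω ⬝ᵥ a ∂μ = 0 := by
  simp only [dotProduct]
  rw [integral_finsetSum _ fun i _ => ((h.1 i).integrable one_le_two).mul_const _]
  simp only [integral_mul_const, h.2.1, zero_mul, Finset.sum_const_zero]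

lemma IsSubgaussianReal.integrable_dotProduct [IsFiniteMeasure μ] {y : Ω → Fin p → ℝ}
    (h : IsSubgaussianReal τ y μ) (a : Fin p → ℝ) : Integrable (fun ω => y ω ⬝ᵥ a) μ :=
  integrable_finsetSum _ fun i _ => ((h.1 i).integrable one_le_two).mul_const _

lemma IsSubgaussian.integral_re_inner [IsFiniteMeasure μ] (h : IsSubgaussian τ y μ)
    (x : EuclideanSpace 𝕜 (Fin p)) : ∫ ω, RCLike.re ⟪WithLp.toLp 2 (y ω), x⟫_𝕜 ∂μ = 0 := by
  simp only [re_inner_toLp]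
  rw [integral_add (h.1.integrable_dotProduct _) (h.2.integrable_dotProduct _),
    h.1.integral_dotProduct, h.2.integral_dotProduct, add_zero]

variable {K : ℝ} (hK : 0 < K) (hτ : τ < K) {c : ℝ} (hc : 0 < c)

include hK hτ hc

lemma IsSubgaussianReal.lintegral_exp_sq_div_le {y : Ω → Fin p → ℝ} (h : IsSubgaussianReal τ y μ)
    {a : Fin p → ℝ} (ha : eLpNorm (fun ω => y ω ⬝ᵥ a) 2 μ ≤ ENNReal.ofReal c) :
    ∫⁻ ω, ENNReal.ofReal (Real.exp ((y ω ⬝ᵥ a) ^ 2 / (K * c) ^ 2)) ∂μ ≤ 2 := by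
  refine lintegral_exp_sq_div_le_of_psiTwoNorm_lt ?_
  calc psiTwoNorm (fun ω => y ω ⬝ᵥ a) μ
      ≤ ENNReal.ofReal τ * eLpNorm (fun ω => y ω ⬝ᵥ a) 2 μ := h.2.2 a
    _ ≤ ENNReal.ofReal τ * ENNReal.ofReal c := by gcongr
    _ = ENNReal.ofReal (τ * c) := (ENNReal.ofReal_mul' hc.le).symm
    _ < ENNReal.ofReal (K * c) := (ENNReal.ofReal_lt_ofReal_iff (by positivity)).2 (by gcongr)

variable (h : IsSubgaussian τ y μ) (hi : IsIsotropic y μ)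

include h hi

section

variable {a : Fin p → ℝ} (ha : ‖WithLp.toLp 2 a‖ ≤ c)

include ha

lemma IsSubgaussian.lintegral_exp_re_dotProduct_sq_div_le :
    ∫⁻ ω, ENNReal.ofReal (Real.exp (((fun i => RCLike.re (y ω i)) ⬝ᵥ a) ^ 2 / (K * c) ^ 2)) ∂μ ≤
      2 :=
  h.1.lintegral_exp_sq_div_le hK hτ hc
    ((hi.eLpNorm_re_dotProduct_le a).trans (ENNReal.ofReal_le_ofReal ha))

lemma IsSubgaussian.lintegral_exp_im_dotProduct_sq_div_le :
    ∫⁻ ω, ENNReal.ofReal (Real.exp (((fun i => RCLike.im (y ω i)) ⬝ᵥ a) ^ 2 / (K * c) ^ 2)) ∂μ ≤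
      2 :=
  h.2.lintegral_exp_sq_div_le hK hτ hc
    ((hi.eLpNorm_im_dotProduct_le a).trans (ENNReal.ofReal_le_ofReal ha))

end

variable {x : EuclideanSpace 𝕜 (Fin p)} (hx : ‖x‖ ≤ c)

include hx

lemma IsSubgaussian.lintegral_exp_re_inner_sq_div_le :
    ∫⁻ ω, ENNReal.ofReal
      (Real.exp (RCLike.re ⟪WithLp.toLp 2 (y ω), x⟫_𝕜 ^ 2 / (4 * (K * c) ^ 2))) ∂μ ≤ 2 := by
  refine lintegral_exp_le_of_le_average
    (((h.1.aemeasurable_dotProduct fun i => RCLike.re (x i)).pow_const 2).div_const _)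
    (h.lintegral_exp_re_dotProduct_sq_div_le hK hτ hc hi <|
      (norm_toLp_le_of_abs_le fun i => RCLike.abs_re_le_norm (x i)).trans hx)
    (h.lintegral_exp_im_dotProduct_sq_div_le hK hτ hc hi <|
      (norm_toLp_le_of_abs_le fun i => RCLike.abs_im_le_norm (x i)).trans hx) fun ω => ?_
  rw [re_inner_toLp]
  exact add_sq_div_four_mul_le (by positivity) _ _

lemma IsSubgaussian.lintegral_exp_im_inner_sq_div_le :
    ∫⁻ ω, ENNReal.ofReal
      (Real.exp (RCLike.im ⟪WithLp.toLp 2 (y ω), x⟫_𝕜 ^ 2 / (4 * (K * c) ^ 2))) ∂μ ≤ 2 := by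
  refine lintegral_exp_le_of_le_average
    (((h.1.aemeasurable_dotProduct fun i => RCLike.im (x i)).pow_const 2).div_const _)
    (h.lintegral_exp_re_dotProduct_sq_div_le hK hτ hc hi <|
      (norm_toLp_le_of_abs_le fun i => RCLike.abs_im_le_norm (x i)).trans hx)
    (h.lintegral_exp_im_dotProduct_sq_div_le hK hτ hc hi <|
      (norm_toLp_le_of_abs_le fun i => RCLike.abs_re_le_norm (x i)).trans hx) fun ω => ?_
  rw [im_inner_toLp, sub_eq_add_neg, ← neg_sq (_ ⬝ᵥ fun i => RCLike.re (x i))]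
  exact add_sq_div_four_mul_le (by positivity) _ _

lemma IsSubgaussian.lintegral_exp_norm_inner_sq_div_le :
    ∫⁻ ω, ENNReal.ofReal
      (Real.exp (‖⟪WithLp.toLp 2 (y ω), x⟫_𝕜‖ ^ 2 / (8 * (K * c) ^ 2))) ∂μ ≤ 2 := by
  refine lintegral_exp_le_of_le_average
    (((hi.memLp_inner x).aestronglyMeasurable.re.aemeasurable.pow_const 2).div_const _)
    (h.lintegral_exp_re_inner_sq_div_le hK hτ hc hi hx)
    (h.lintegral_exp_im_inner_sq_div_le hK hτ hc hi hx) fun ω => ?_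
  rw [RCLike.norm_sq_eq_def, ← add_div, div_div]
  refine le_of_eq ?_
  ring

omit hc hx in
lemma IsSubgaussian.hasSubgaussianMGF_re_inner [IsProbabilityMeasure μ] :
    HasSubgaussianMGF (fun ω => RCLike.re ⟪WithLp.toLp 2 (y ω), x⟫_𝕜)
      (Real.toNNReal (8 * K ^ 2 * ‖x‖ ^ 2)) μ := by
  rcases eq_or_ne x 0 with rfl | hx
  · simp
  · have hx' : 0 < ‖x‖ := norm_pos_iff.2 hx
    have hmgf := hasSubgaussianMGF_of_lintegral_exp_sq_div_le
      (v := Real.toNNReal (4 * (K * ‖x‖) ^ 2)) ((hi.memLp_inner x).integrable one_le_two).re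
      (by simpa only [Real.coe_toNNReal _ (show 0 ≤ 4 * (K * ‖x‖) ^ 2 by positivity),
        ENNReal.coe_ofNat] using h.lintegral_exp_re_inner_sq_div_le hK hτ hx' hi le_rfl)
      (h.integral_re_inner x) (Real.toNNReal_pos.2 (by positivity))
    convert! hmgf using 1
    rw [← Real.toNNReal_ofNat, ← Real.toNNReal_mul two_pos.le]
    ring_nf

end Subgaussian

end RandomVectors

section RandomMatrix

variable {𝕜 : Type*} [RCLike 𝕜] {n p : ℕ}

lemma hasSubgaussianMGF_of_le {Ω : Type*} [MeasurableSpace Ω] {μ : Measure Ω} {X : Ω → ℝ}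
    {c d : ℝ≥0} (h : HasSubgaussianMGF X c μ) (hcd : c ≤ d) : HasSubgaussianMGF X d μ :=
  ⟨h.integrable_exp_mul, fun t => (h.mgf_le t).trans <| Real.exp_le_exp.2 <| by gcongr⟩

lemma measurable_inner_toLp (x : EuclideanSpace 𝕜 (Fin p)) :
    Measurable fun z : Fin p → 𝕜 => ⟪WithLp.toLp 2 z, x⟫_𝕜 :=
  ((PiLp.continuous_toLp 2 _).inner continuous_const).measurable

variable {Ω : Type*} {Z : Ω → Matrix (Fin n) (Fin p) 𝕜}

lemma toEuclideanLin_apply_eq_inner_rowVec (ω : Ω) (x : EuclideanSpace 𝕜 (Fin p)) (k : Fin n) :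
    toEuclideanLin (Z ω) x k = ⟪WithLp.toLp 2 (rowVec Z k ω), x⟫_𝕜 := by
  simp [rowVec, PiLp.inner_apply, Matrix.ofLp_toLpLin, Matrix.mulVec, dotProduct, mul_comm]

lemma re_inner_toEuclideanLin_eq_sum (u : EuclideanSpace 𝕜 (Fin n)) (w : EuclideanSpace 𝕜 (Fin p))
    (ω : Ω) : RCLike.re ⟪u, toEuclideanLin (Z ω) w⟫_𝕜 =
      ∑ k, RCLike.re ⟪WithLp.toLp 2 (rowVec Z k ω), star (u k) • w⟫_𝕜 := by
  simp only [PiLp.inner_apply u, map_sum, toEuclideanLin_apply_eq_inner_rowVec, inner_smul_right,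
    RCLike.inner_apply', RCLike.star_def]

lemma norm_sq_toEuclideanLin_eq_sum (x : EuclideanSpace 𝕜 (Fin p)) (ω : Ω) :
    ‖toEuclideanLin (Z ω) x‖ ^ 2 = ∑ k, ‖⟪WithLp.toLp 2 (rowVec Z k ω), x⟫_𝕜‖ ^ 2 := by
  simp only [EuclideanSpace.norm_sq_eq, toEuclideanLin_apply_eq_inner_rowVec]

variable [MeasurableSpace Ω] {μ : Measure Ω} [IsProbabilityMeasure μ] {τ K : ℝ} (hK : 0 < K)
  (hτ : τ < K) (hind : iIndepFun (fun k => rowVec Z k) μ) (hiso : ∀ k, IsIsotropic (rowVec Z k) μ)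
  (hsub : ∀ k, IsSubgaussian τ (rowVec Z k) μ)

include hK hτ hind hiso hsub

lemma hasSubgaussianMGF_re_inner_toEuclideanLin (u : EuclideanSpace 𝕜 (Fin n))
    (w : EuclideanSpace 𝕜 (Fin p)) :
    HasSubgaussianMGF (fun ω => RCLike.re ⟪u, toEuclideanLin (Z ω) w⟫_𝕜)
      (Real.toNNReal (8 * K ^ 2 * (‖u‖ ^ 2 * ‖w‖ ^ 2))) μ := by
  have hindep : iIndepFun
      (fun k ω => RCLike.re ⟪WithLp.toLp 2 (rowVec Z k ω), star (u k) • w⟫_𝕜) μ :=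
    hind.comp _ fun k => RCLike.measurable_re.comp (measurable_inner_toLp _)
  have hvar : Real.toNNReal (8 * K ^ 2 * (‖u‖ ^ 2 * ‖w‖ ^ 2)) =
      ∑ k, Real.toNNReal (8 * K ^ 2 * ‖star (u k) • w‖ ^ 2) := by
    rw [← Real.toNNReal_sum_of_nonneg fun _ _ => by positivity, EuclideanSpace.norm_sq_eq u,
      Finset.sum_mul, Finset.mul_sum]
    simp only [norm_smul, norm_star, mul_pow]
  simp only [re_inner_toEuclideanLin_eq_sum, hvar]
  exact HasSubgaussianMGF.sum_of_iIndepFun hindep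
    (fun k _ => (hsub k).hasSubgaussianMGF_re_inner hK hτ (hiso k))

lemma measureReal_le_re_inner_toEuclideanLin_le {a b : ℝ} {u : EuclideanSpace 𝕜 (Fin n)}
    {w : EuclideanSpace 𝕜 (Fin p)} (hu : ‖u‖ ≤ a) (hw : ‖w‖ ≤ b) {s : ℝ} (hs : 0 ≤ s) :
    μ.real {ω | s ≤ RCLike.re ⟪u, toEuclideanLin (Z ω) w⟫_𝕜} ≤
      Real.exp (-s ^ 2 / (16 * K ^ 2 * (a ^ 2 * b ^ 2))) := by
  have hmgf := hasSubgaussianMGF_of_le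
    (hasSubgaussianMGF_re_inner_toEuclideanLin hK hτ hind hiso hsub u w)
    (d := Real.toNNReal (8 * K ^ 2 * (a ^ 2 * b ^ 2))) (by gcongr)
  refine (hmgf.measure_ge_le hs).trans_eq ?_
  rw [Real.coe_toNNReal _ (by positivity)]
  ring_nf

variable [NeZero n] (hZ : ∀ i j, Measurable fun ω => Z ω i j)

include hZ

lemma measureReal_le_abs_norm_sq_toEuclideanLin_sub_le {c : ℝ} (hc : 0 < c)
    {x : EuclideanSpace 𝕜 (Fin p)} (hx : ‖x‖ ≤ c) {s : ℝ} (hs : 0 ≤ s) :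
    μ.real {ω | s ≤ |‖toEuclideanLin (Z ω) x‖ ^ 2 - n * ‖x‖ ^ 2|} ≤
      2 * Real.exp (-min (s ^ 2 / (192 * n * (8 * (K * c) ^ 2) ^ 2))
        (s / (4 * (8 * (K * c) ^ 2)))) := by
  have hmeas : Measurable fun z : Fin p → 𝕜 => ‖⟪WithLp.toLp 2 z, x⟫_𝕜‖ ^ 2 :=
    (measurable_inner_toLp x).norm.pow_const 2
  have hrow : ∀ k, Measurable (rowVec Z k) := fun k =>
    measurable_pi_iff.2 fun j => continuous_star.measurable.comp (hZ k j)
  have hbern := measureReal_le_abs_sum_sub_integral_le (fun k => hmeas.comp (hrow k))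
    (fun _ _ => sq_nonneg _) (hind.comp _ fun _ => hmeas) (M := 8 * (K * c) ^ 2) (by positivity)
    (fun k => (hsub k).lintegral_exp_norm_inner_sq_div_le hK hτ hc (hiso k) hx) hs
  simpa only [Function.comp_apply, (hiso _).integral_norm_inner_sq, Finset.sum_sub_distrib,
    ← norm_sq_toEuclideanLin_eq_sum, Finset.sum_const, Finset.card_univ, Fintype.card_fin,
    nsmul_eq_mul] using hbern

end RandomMatrix

section GramDeviation

variable {𝕜 : Type*} [RCLike 𝕜] {n p : ℕ}

/-- The operator `Aᴴ A - n`, the deviation of `Aᴴ A` from its mean when `A` is a random matrix with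
`n` isotropic rows. -/
noncomputable def gramDeviation (A : Matrix (Fin n) (Fin p) 𝕜) :
    EuclideanSpace 𝕜 (Fin p) →L[𝕜] EuclideanSpace 𝕜 (Fin p) :=
  LinearMap.toContinuousLinearMap
    (LinearMap.adjoint (toEuclideanLin A) ∘ₗ toEuclideanLin A - (n : 𝕜) • .id)

lemma inner_gramDeviation (A : Matrix (Fin n) (Fin p) 𝕜) (x y : EuclideanSpace 𝕜 (Fin p)) :
    ⟪x, gramDeviation A y⟫_𝕜 = ⟪toEuclideanLin A x, toEuclideanLin A y⟫_𝕜 - n * ⟪x, y⟫_𝕜 := by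
  rw [gramDeviation, LinearMap.coe_toContinuousLinearMap', LinearMap.sub_apply, inner_sub_right,
    LinearMap.comp_apply, LinearMap.adjoint_inner_right, LinearMap.smul_apply, inner_smul_right,
    LinearMap.id_apply]

lemma re_inner_gramDeviation (A : Matrix (Fin n) (Fin p) 𝕜) (x y : EuclideanSpace 𝕜 (Fin p)) :
    RCLike.re ⟪x, gramDeviation A y⟫_𝕜 =
      ((‖toEuclideanLin A (x + y)‖ ^ 2 - n * ‖x + y‖ ^ 2) -
        (‖toEuclideanLin A (x - y)‖ ^ 2 - n * ‖x - y‖ ^ 2)) / 4 := by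
  rw [inner_gramDeviation, map_sub, ← RCLike.ofReal_natCast, RCLike.re_ofReal_mul,
    re_inner_eq_norm_add_mul_self_sub_norm_sub_mul_self_div_four,
    re_inner_eq_norm_add_mul_self_sub_norm_sub_mul_self_div_four x, map_add, map_sub]
  ring

end GramDeviation

section OperatorNormTails

/-- The rate `c` for which the bounds `exp (-c q)` below hold when the rows of the noise are
`τ`-subgaussian with `τ < K`. The number `786432 = 48 * 128 ^ 2` comes from Bernstein's inequality
for `‖Z x‖ ^ 2` with `‖x‖ ≤ 4`. -/
noncomputable def tailRate (K : ℝ) : ℝ := 1 / (786432 * K ^ 4)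

lemma tailRate_pos {K : ℝ} (hK : 0 < K) : 0 < tailRate K := by
  unfold tailRate
  positivity

lemma tailRate_mul_le {K q : ℝ} (hK : 1 ≤ K) (hq : 0 ≤ q) :
    tailRate K * q ≤ q / (256 * K ^ 2) := by
  rw [tailRate, one_div_mul_eq_div]
  gcongr
  · norm_num
  · norm_num

lemma tailRate_mul_le_min {K q n : ℝ} (hK : 1 ≤ K) (hq : 0 ≤ q) (hn : 0 < n) :
    tailRate K * q ≤ min ((2 * (√(q * n) + q)) ^ 2 / (192 * n * (8 * (K * 4) ^ 2) ^ 2))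
      (2 * (√(q * n) + q) / (4 * (8 * (K * 4) ^ 2))) := by
  have : 0 < K := by positivity
  refine le_min ?_ ?_
  · calc tailRate K * q = (2 * √(q * n)) ^ 2 / (192 * n * (8 * (K * 4) ^ 2) ^ 2) := by
          rw [mul_pow, Real.sq_sqrt (by positivity), tailRate]
          field
      _ ≤ _ := by
          gcongr
          exact le_add_of_nonneg_right hq
  · calc tailRate K * q ≤ q / (256 * K ^ 2) := tailRate_mul_le hK hq
      _ = 2 * q / (4 * (8 * (K * 4) ^ 2)) := by field
      _ ≤ _ := by
          gcongr
          exact le_add_of_nonneg_left (Real.sqrt_nonneg _)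

variable {𝕜 : Type*} [RCLike 𝕜] {n p : ℕ} {Ω : Type*} {Z : Ω → Matrix (Fin n) (Fin p) 𝕜}
  [MeasurableSpace Ω] {μ : Measure Ω} [IsProbabilityMeasure μ] {τ K : ℝ} (hK : 1 ≤ K)
  (hτ : τ < K) (hind : iIndepFun (fun k => rowVec Z k) μ) (hiso : ∀ k, IsIsotropic (rowVec Z k) μ)
  (hsub : ∀ k, IsSubgaussian τ (rowVec Z k) μ) {q : ℝ} (hq : 0 ≤ q)

include hK hτ hind hiso hsub hq

lemma measureReal_lt_opNorm_comp_toEuclideanLin_le {F : Type*} [NormedAddCommGroup F]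
    [InnerProductSpace 𝕜 F] [FiniteDimensional 𝕜 F] {P : EuclideanSpace 𝕜 (Fin n) →L[𝕜] F}
    (hP : ‖P‖ ≤ 1) :
    μ.real {ω | √q < ‖P ∘L LinearMap.toContinuousLinearMap (toEuclideanLin (Z ω))‖} ≤
      25 ^ (p + finrank 𝕜 F) * Real.exp (-(tailRate K * q)) := by
  have hdim : p + finrank 𝕜 F = finrank 𝕜 (EuclideanSpace 𝕜 (Fin p)) + finrank 𝕜 F := by
    rw [finrank_euclideanSpace_fin]
  rw [hdim]
  have := FiniteDimensional.complete 𝕜 F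
  refine measureReal_lt_opNorm_le _ fun w u hw hu => ?_
  have hPu : ‖P.adjoint u‖ ≤ 2 := by
    have := P.adjoint.le_of_opNorm_le_of_le ((LinearIsometryEquiv.norm_map _ P).trans_le hP) hu
    rwa [one_mul] at this
  calc μ.real {ω | √q ≤ RCLike.re ⟪u, (P ∘L
        LinearMap.toContinuousLinearMap (toEuclideanLin (Z ω))) w⟫_𝕜}
      = μ.real {ω | √q ≤ RCLike.re ⟪P.adjoint u, toEuclideanLin (Z ω) w⟫_𝕜} := by
        simp only [ContinuousLinearMap.adjoint_inner_left, ContinuousLinearMap.comp_apply,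
          LinearMap.coe_toContinuousLinearMap']
    _ ≤ Real.exp (-√q ^ 2 / (16 * K ^ 2 * (2 ^ 2 * 2 ^ 2))) :=
        measureReal_le_re_inner_toEuclideanLin_le (by positivity) hτ hind hiso hsub hPu hw
          (Real.sqrt_nonneg q)
    _ ≤ Real.exp (-(tailRate K * q)) := by
        rw [Real.sq_sqrt hq, neg_div]
        gcongr
        exact (tailRate_mul_le hK hq).trans_eq (by ring)

variable [NeZero n] (hZ : ∀ i j, Measurable fun ω => Z ω i j)

include hZ

lemma measureReal_le_abs_norm_sq_sub_le_exp {x : EuclideanSpace 𝕜 (Fin p)} (hx : ‖x‖ ≤ 4) :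
    μ.real {ω | 2 * (√(q * n) + q) ≤ |‖toEuclideanLin (Z ω) x‖ ^ 2 - n * ‖x‖ ^ 2|} ≤
      2 * Real.exp (-(tailRate K * q)) := by
  refine (measureReal_le_abs_norm_sq_toEuclideanLin_sub_le (by positivity) hτ hind hiso hsub hZ
    four_pos hx (by positivity)).trans ?_
  gcongr
  exact tailRate_mul_le_min hK hq (Nat.cast_pos.2 (NeZero.pos n))

lemma measureReal_lt_opNorm_gramDeviation_le :
    μ.real {ω | √(q * n) + q < ‖gramDeviation (Z ω)‖} ≤
      25 ^ (2 * p) * (4 * Real.exp (-(tailRate K * q))) := by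
  have hdim : 2 * p = finrank 𝕜 (EuclideanSpace 𝕜 (Fin p)) +
      finrank 𝕜 (EuclideanSpace 𝕜 (Fin p)) := by
    rw [finrank_euclideanSpace_fin, two_mul]
  rw [hdim]
  refine measureReal_lt_opNorm_le _ fun w u hw hu => ?_
  have htail := fun x hx => measureReal_le_abs_norm_sq_sub_le_exp (x := x) hK hτ hind hiso hsub hq
    hZ hx
  have hsum := htail (u + w) ((norm_add_le u w).trans (by linarith))
  have hdiff := htail (u - w) ((norm_sub_le u w).trans (by linarith))
  have hunion := (measureReal_union_le (μ := μ) _ _).trans (add_le_add hsum hdiff)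
  rw [← add_mul, two_add_two_eq_four] at hunion
  refine (measureReal_mono fun ω hω => ?_).trans hunion
  rw [Set.mem_ofPred_eq, re_inner_gramDeviation] at hω
  by_contra! hcon
  simp only [Set.mem_union, Set.mem_ofPred_eq, not_or, not_le] at hcon
  linarith [lt_of_abs_lt hcon.1, neg_lt_of_abs_lt hcon.2]

end OperatorNormTails

section NoiseEvent

variable {𝕜 : Type*} [RCLike 𝕜]

lemma exists_norm_inner_le_norm_mul_norm_apply {E : Type*} [NormedAddCommGroup E]
    [InnerProductSpace 𝕜 E] (S : Submodule 𝕜 E) [FiniteDimensional 𝕜 S] :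
    ∃ P : E →L[𝕜] EuclideanSpace 𝕜 (Fin (finrank 𝕜 S)), ‖P‖ ≤ 1 ∧
      ∀ x ∈ S, ∀ y, ‖⟪x, y⟫_𝕜‖ ≤ ‖x‖ * ‖P y‖ := by
  let b := (stdOrthonormalBasis 𝕜 S).repr
  refine ⟨b.toLinearIsometry.toContinuousLinearMap ∘L S.orthogonalProjectionOnto,
    ContinuousLinearMap.opNorm_le_bound _ zero_le_one fun y => ?_, fun x hx y => ?_⟩
  · rw [one_mul]
    exact (b.norm_map _).trans_le (S.norm_orthogonalProjectionOnto_apply_le y)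
  · calc ‖⟪x, y⟫_𝕜‖ = ‖⟪(⟨x, hx⟩ : S), S.orthogonalProjectionOnto y⟫_𝕜‖ := by
          rw [Submodule.inner_orthogonalProjectionOnto_eq_of_mem_left]
      _ ≤ ‖x‖ * ‖S.orthogonalProjectionOnto y‖ := norm_inner_le_norm _ _
      _ = _ := congrArg (‖x‖ * ·) (b.norm_map _).symm

variable {n p : ℕ} {A : Matrix (Fin n) (Fin p) 𝕜} {t : ℝ}

lemma norm_inner_sub_le_of_opNorm_gramDeviation_le (hA : ‖gramDeviation A‖ ≤ t)
    (x y : EuclideanSpace 𝕜 (Fin p)) :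
    ‖⟪toEuclideanLin A x, toEuclideanLin A y⟫_𝕜 - n * ⟪x, y⟫_𝕜‖ ≤ t * ‖x‖ * ‖y‖ := by
  calc _ = ‖⟪x, gramDeviation A y⟫_𝕜‖ := by rw [inner_gramDeviation]
    _ ≤ ‖x‖ * ‖gramDeviation A y‖ := norm_inner_le_norm _ _
    _ ≤ ‖x‖ * (t * ‖y‖) := by
        gcongr
        exact ContinuousLinearMap.le_of_opNorm_le _ hA y
    _ = t * ‖x‖ * ‖y‖ := by ring

variable {Ω : Type*} {Z : Ω → Matrix (Fin n) (Fin p) 𝕜} [MeasurableSpace Ω] {μ : Measure Ω}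
  [IsProbabilityMeasure μ] {τ K : ℝ} [NeZero n]

lemma exists_measurableSet_opNorm_le (hK : 1 ≤ K) (hτ : τ < K)
    (hind : iIndepFun (fun k => rowVec Z k) μ) (hiso : ∀ k, IsIsotropic (rowVec Z k) μ)
    (hsub : ∀ k, IsSubgaussian τ (rowVec Z k) μ) {q : ℝ} (hq : 0 ≤ q)
    (hZ : ∀ i j, Measurable fun ω => Z ω i j) {F : Type*} [NormedAddCommGroup F]
    [InnerProductSpace 𝕜 F] [FiniteDimensional 𝕜 F] (hF : finrank 𝕜 F ≤ p)
    {P : EuclideanSpace 𝕜 (Fin n) →L[𝕜] F} (hP : ‖P‖ ≤ 1) :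
    ∃ E, MeasurableSet E ∧ 1 - 5 * 25 ^ (2 * p) * Real.exp (-(tailRate K * q)) ≤ μ.real E ∧
      ∀ ω ∈ E, ‖P ∘L LinearMap.toContinuousLinearMap (toEuclideanLin (Z ω))‖ ≤ √q ∧
        ‖gramDeviation (Z ω)‖ ≤ √(q * n) + q := by
  set B := {ω | √q < ‖P ∘L LinearMap.toContinuousLinearMap (toEuclideanLin (Z ω))‖} ∪
    {ω | √(q * n) + q < ‖gramDeviation (Z ω)‖} with hBdef
  have hB : μ.real B ≤ 5 * 25 ^ (2 * p) * Real.exp (-(tailRate K * q)) := by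
    calc μ.real B
        ≤ 25 ^ (p + finrank 𝕜 F) * Real.exp (-(tailRate K * q)) +
            25 ^ (2 * p) * (4 * Real.exp (-(tailRate K * q))) :=
          (measureReal_union_le _ _).trans <| add_le_add
            (measureReal_lt_opNorm_comp_toEuclideanLin_le hK hτ hind hiso hsub hq hP)
            (measureReal_lt_opNorm_gramDeviation_le hK hτ hind hiso hsub hq hZ)
      _ ≤ 25 ^ (2 * p) * Real.exp (-(tailRate K * q)) +
            25 ^ (2 * p) * (4 * Real.exp (-(tailRate K * q))) := by
          gcongr
          · norm_num
          · omega
      _ = 5 * 25 ^ (2 * p) * Real.exp (-(tailRate K * q)) := by ring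
  refine ⟨(toMeasurable μ B)ᶜ, (measurableSet_toMeasurable μ B).compl, ?_, fun ω hω => ?_⟩
  · rw [probReal_compl_eq_one_sub (measurableSet_toMeasurable μ B), measureReal_def,
      measure_toMeasurable, ← measureReal_def]
    linarith
  · have hωB : ω ∉ B := fun h => hω (subset_toMeasurable μ B h)
    simpa only [hBdef, Set.mem_union, Set.mem_ofPred_eq, not_or, not_lt] using hωB

end NoiseEvent

section Rates

lemma five_mul_pow_mul_exp_le {p : ℕ} (hp : 1 ≤ p) {x : ℝ} (hx : 20 * p ≤ x) :
    5 * 25 ^ (2 * p) * Real.exp (-x) ≤ Real.exp (-(x / 2)) := by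
  have hfive : (5 : ℝ) ≤ Real.exp 2 := by
    have : (2.7 : ℝ) ^ 2 ≤ Real.exp 1 ^ 2 := by
      gcongr
      linarith [Real.exp_one_gt_d9]
    rw [← Real.exp_nat_mul] at this
    norm_num at this
    linarith
  have hpow : (5 : ℝ) * 25 ^ (2 * p) ≤ Real.exp (10 * p) := by
    calc (5 : ℝ) * 25 ^ (2 * p) = 5 ^ (4 * p + 1) := by
          rw [show (25 : ℝ) = 5 ^ 2 by norm_num, ← pow_mul]
          ring
      _ ≤ 5 ^ (5 * p) := pow_le_pow_right₀ (by norm_num) (by omega)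
      _ ≤ Real.exp 2 ^ (5 * p) := by gcongr
      _ = Real.exp (10 * p) := by
          rw [← Real.exp_nat_mul]
          push_cast
          ring_nf
  calc _ ≤ Real.exp (10 * p) * Real.exp (-x) := by gcongr
    _ = Real.exp (10 * p - x) := by rw [← Real.exp_add, sub_eq_add_neg]
    _ ≤ _ := Real.exp_le_exp.2 (by linarith)

variable {q s n : ℝ} (hq : 0 ≤ q) (hs : 0 < s) (hn : 0 ≤ n)

include hq hn hs

lemma sixteen_mul_sqrt_le_of_mul_add_le_pow_four (h : 1000 * q * (s ^ 2 + n) ≤ s ^ 4) :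
    16 * √q ≤ s ∧ 16 * (√(q * n) + q) ≤ s ^ 2 := by
  have hqs : 1000 * q ≤ s ^ 2 := by
    refine le_of_mul_le_mul_right ?_ (pow_pos hs 2)
    nlinarith [mul_nonneg hq hn]
  have hqn : 1000 * (q * n) ≤ (s ^ 2) ^ 2 := by nlinarith [mul_nonneg hq (sq_nonneg s)]
  have hsqrt : 31 * √(q * n) ≤ s ^ 2 := by
    refine le_of_sq_le_sq ?_ (by positivity)
    rw [mul_pow, Real.sq_sqrt (by positivity)]
    linarith [mul_nonneg hq hn]
  refine ⟨le_of_sq_le_sq ?_ hs.le, by linarith⟩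
  rw [mul_pow, Real.sq_sqrt hq]
  linarith

lemma sq_sqrt_div_add_div_le (hqs : q ≤ s ^ 2) :
    (√q / s + (√(q * n) + q) / s ^ 2) ^ 2 ≤ 6 * (q * (s ^ 2 + n) / s ^ 4) := by
  calc (√q / s + (√(q * n) + q) / s ^ 2) ^ 2
      = (√q * s + √(q * n) + q) ^ 2 / s ^ 4 := by field
    _ ≤ 3 * ((√q * s) ^ 2 + √(q * n) ^ 2 + q ^ 2) / s ^ 4 := by
        gcongr
        linarith [sq_nonneg (√q * s - √(q * n)), sq_nonneg (√q * s - q), sq_nonneg (√(q * n) - q)]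
    _ = 3 * (q * s ^ 2 + q * n + q ^ 2) / s ^ 4 := by
        rw [mul_pow, Real.sq_sqrt hq, Real.sq_sqrt (by positivity)]
    _ ≤ 3 * (q * s ^ 2 + q * n + q * (s ^ 2 + n)) / s ^ 4 := by
        rw [sq q]
        gcongr
        linarith
    _ = 6 * (q * (s ^ 2 + n) / s ^ 4) := by ring

end Rates

section SinTheta

variable {𝕜 : Type*} [RCLike 𝕜] {m n r : ℕ} {hm : r ≤ m} {hn : r ≤ n}
  {A B : Matrix (Fin m) (Fin n) 𝕜} {U U' : Matrix (Fin m) (Fin r) 𝕜}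
  {S S' : Matrix (Fin r) (Fin r) 𝕜} {V V' : Matrix (Fin n) (Fin r) 𝕜}

lemma opNorm_sinMatrix_le_one : opNorm (sinMatrix V V') ≤ 1 :=
  opNorm_sinMatrix_le zero_le_one fun _ => Real.sin_le_one _

lemma sq_opNorm_sinMatrix_le_min {F : Type*} [NormedAddCommGroup F] [InnerProductSpace 𝕜 F]
    {P : EuclideanSpace 𝕜 (Fin m) →L[𝕜] F} {q : ℝ} (hq : 0 ≤ q) (hr : 1 ≤ r) (hrank : A.rank = r)
    (hSVD : IsTruncatedSVD hm hn A U S V) (hSVD' : IsTruncatedSVD hm hn (A + B) U' S' V')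
    (hP : ∀ x ∈ LinearMap.range (toEuclideanLin A), ∀ y, ‖⟪x, y⟫_𝕜‖ ≤ ‖x‖ * ‖P y‖)
    (hPB : ‖P ∘L LinearMap.toContinuousLinearMap (toEuclideanLin B)‖ ≤ √q)
    (hB : ‖gramDeviation B‖ ≤ √(q * m) + q) :
    opNorm (sinMatrix V V') ^ 2 ≤ min 1 (1000 * q * (sval A r ^ 2 + m) / sval A r ^ 4) := by
  have hnonneg : 0 ≤ opNorm (sinMatrix V V') := norm_nonneg _
  have hone : opNorm (sinMatrix V V') ^ 2 ≤ 1 := pow_le_one₀ hnonneg opNorm_sinMatrix_le_one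
  refine le_min hone ?_
  have hs : 0 < sval A r := by
    rw [sval, LinearMap.singularValues_pos_iff_lt_finrank_range, finrank_range_toEuclideanLin]
    omega
  rcases le_or_gt 1 (1000 * q * (sval A r ^ 2 + m) / sval A r ^ 4) with hlarge | hsmall
  · exact hone.trans hlarge
  have hm0 : (0 : ℝ) ≤ m := m.cast_nonneg
  obtain ⟨hρ, hε⟩ := sixteen_mul_sqrt_le_of_mul_add_le_pow_four hq hs hm0
    ((div_lt_one (by positivity)).1 hsmall).le
  have hAB (x y) : ‖⟪toEuclideanLin A x, toEuclideanLin B y⟫_𝕜‖ ≤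
      √q * ‖toEuclideanLin A x‖ * ‖y‖ := by
    calc _ ≤ ‖toEuclideanLin A x‖ * ‖P (toEuclideanLin B y)‖ := hP _ ⟨x, rfl⟩ _
      _ ≤ ‖toEuclideanLin A x‖ * (√q * ‖y‖) := by
          gcongr
          exact ContinuousLinearMap.le_of_opNorm_le _ hPB y
      _ = _ := by ring
  have hsin := opNorm_sinMatrix_le_of_isTruncatedSVD hr hrank hSVD hSVD' hAB
    (by simpa only [RCLike.ofReal_natCast] using norm_inner_sub_le_of_opNorm_gramDeviation_le hB)
    hm0 (Real.sqrt_nonneg q) hρ (by positivity) hε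
  have hqs : q ≤ sval A r ^ 2 := by linarith [Real.sqrt_nonneg (q * m)]
  calc opNorm (sinMatrix V V') ^ 2
      ≤ (4 / 3 * (√q / sval A r + (√(q * m) + q) / sval A r ^ 2)) ^ 2 := by gcongr
    _ ≤ (4 / 3) ^ 2 * (6 * (q * (sval A r ^ 2 + m) / sval A r ^ 4)) := by
        rw [mul_pow]
        gcongr
        exact sq_sqrt_div_add_div_le hq hs hm0 hqs
    _ ≤ 1000 * (q * (sval A r ^ 2 + m) / sval A r ^ 4) := by
        rw [← mul_assoc]
        gcongr
        norm_num
    _ = _ := by ring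

end SinTheta

end SubspaceSVD

theorem theorem6 :
    ∃ C : ℝ, 0 < C ∧ ∀ τ : ℝ, 0 < τ →
      ∃ α_τ c_τ : ℝ, 0 ≤ α_τ ∧ 0 < c_τ ∧
        ∀ (𝕜 : Type*) [RCLike 𝕜] (Ω : Type*) [MeasurableSpace Ω] (μ : Measure Ω)
          [IsProbabilityMeasure μ] (p₁ p₂ r : ℕ) (_ : 1 ≤ r) (h₁ : r ≤ p₁) (h₂ : r ≤ p₂)
          (X : Matrix (Fin p₁) (Fin p₂) 𝕜) (U : Matrix (Fin p₁) (Fin r) 𝕜)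
          (S : Matrix (Fin r) (Fin r) 𝕜) (V : Matrix (Fin p₂) (Fin r) 𝕜)
          (Z : Ω → Matrix (Fin p₁) (Fin p₂) 𝕜),
          X.rank = r →
          IsTruncatedSVD h₁ h₂ X U S V →
          (∀ i j, Measurable fun ω => Z ω i j) →
          iIndepFun (fun k => rowVec Z k) μ →
          (∀ k, IsIsotropic (rowVec Z k) μ) →
          (∀ k, IsSubgaussian τ (rowVec Z k) μ) →
          ∀ α : ℝ, α_τ ≤ α →
            ∃ E : Set Ω, MeasurableSet E ∧
              1 - Real.exp (-(c_τ * α * p₂)) ≤ μ.real E ∧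
              ∀ ω ∈ E, ∀ (U' : Matrix (Fin p₁) (Fin r) 𝕜) (S' : Matrix (Fin r) (Fin r) 𝕜)
                (V' : Matrix (Fin p₂) (Fin r) 𝕜),
                IsTruncatedSVD h₁ h₂ (X + Z ω) U' S' V' →
                opNorm (sinMatrix V V') ^ 2 ≤
                  min 1 (C * α * p₂ * (sval X r ^ 2 + p₁) / sval X r ^ 4) := by
  refine ⟨1000, by norm_num, fun τ hτ => ?_⟩
  have hrate : 0 < tailRate (τ + 1) := tailRate_pos (by positivity)
  refine ⟨20 / tailRate (τ + 1), tailRate (τ + 1) / 2, by positivity, by positivity, ?_⟩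
  intro 𝕜 _ Ω _ μ _ p₁ p₂ r hr h₁ h₂ X U S V Z hX hSVD hZ hind hiso hsub α hα
  have : NeZero p₁ := ⟨by omega⟩
  have hα0 : 0 ≤ α := le_trans (by positivity) hα
  obtain ⟨P, hPnorm, hP⟩ :=
    exists_norm_inner_le_norm_mul_norm_apply (LinearMap.range (Matrix.toEuclideanLin X))
  obtain ⟨E, hE, hμE, hbounds⟩ := exists_measurableSet_opNorm_le (q := α * p₂) (by linarith)
    (lt_add_one τ) hind hiso hsub (by positivity) hZ
    (by rwa [finrank_euclideanSpace_fin, finrank_range_toEuclideanLin, hX]) hPnorm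
  refine ⟨E, hE, ?_, fun ω hω U' S' V' hSVD' => ?_⟩
  · have hexp := five_mul_pow_mul_exp_le (x := tailRate (τ + 1) * (α * p₂)) (hr.trans h₂) (by
      rw [← mul_assoc]
      gcongr
      exact (div_le_iff₀' hrate).1 hα)
    rw [show tailRate (τ + 1) / 2 * α * p₂ = tailRate (τ + 1) * (α * p₂) / 2 by ring]
    linarith
  · rw [mul_assoc 1000 α]
    exact sq_opNorm_sinMatrix_le_min (by positivity) hr hX hSVD hSVD' hP (hbounds ω hω).1
      (hbounds ω hω).2
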